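/- Let $0<a<c\le 1$ and $K>1$. For $0<x<1$ let $F(x)=\sum_{n\ge 0}\frac{(a)_n(c-a)_n}{(c)_n}\frac{x^n}{n!}$ with $(q)_n=q(q+1)\cdots(q+n-1)$, let $B=B(a,c-a)=\Gamma(a)\Gamma(c-a)/\Gamma(c)$, and for $r\in(0,1)$ write $r'=\sqrt{1-r^2}$, $$\mathsf K(r)=\tfrac{B}{2}F(r^2),\qquad \mathsf K'(r)=\mathsf K(r'),\qquad \mu(r)=\tfrac{B}{2}\,\frac{F(r'^2)}{F(r^2)} .$$ The function $\mu$ is a decreasing homeomorphism of $(0,1)$ onto $(0,\infty)$; for $L>0$ put $\varphi_L(r)=\mu^{-1}(\mu(r)/L)\in(0,1)$. Let $s=\varphi_K(r)$ and $t=\varphi_{1/K}(r)$, $r\in(0,1)$. Then, as functions of $r$: (1) $s/r$ is strictly decreasing from $(0,1)$ onto $(1,\infty)$; (2) $s'/r'$ is strictly decreasing from $(0,1)$ onto $(0,1)$; (3) $\mathsf K(s)/\mathsf K(r)$ is strictly increasing from $(0,1)$ onto $(1,K)$; (4) $\mathsf K'(s)/\mathsf K'(r)$ is strictly increasing from $(0,1)$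 onto $(1/K,1)$; (5) $s'\,\mathsf K(s)^2/(r'\,\mathsf K(r)^2)$ is strictly decreasing from $(0,1)$ onto $(0,1)$; (6) $s\,\mathsf K'(s)^2/(r\,\mathsf K'(r)^2)$ is strictly decreasing from $(0,1)$ onto $(1,\infty)$; (7) $t/r$ is strictly increasing from $(0,1)$ onto $(0,1)$; (8) $t'/r'$ is strictly increasing from $(0,1)$ onto $(1,\infty)$; (9) $\mathsf K(t)/\mathsf K(r)$ is strictly decreasing from $(0,1)$ onto $(1/K,1)$; (10) $\mathsf K'(t)/\mathsf K'(r)$ is strictly decreasing from $(0,1)$ onto $(1,K)$; (11) $t'\,\mathsf K(t)^2/(r'\,\mathsf K(r)^2)$ is strictly increasing from $(0,1)$ onto $(1,\infty)$; (12) $t\,\mathsf K'(t)^2/(r\,\mathsf K'(r)^2)$ is strictly increasing from $(0,1)$ onto $(0,1)$. -/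

import Mathlib

noncomputable section

namespace GenElliptic

/-- The complementary argument `r' = √(1 - r²)`. -/
def compl (r : ℝ) : ℝ := Real.sqrt (1 - r ^ 2)

/-- The generalized complete elliptic integral of the first kind
`K_{a,b,c}(r) = (B(a,b)/2) F(a,b;c;r²)`, for `0 < r < 1`. -/
def ellipticK₃ (a b c r : ℝ) : ℝ :=
  ProbabilityTheory.beta a b / 2 * ordinaryHypergeometric a b c (r ^ 2)

/-- The generalized modulus `μ_{a,b,c}(r) = (B(a,b)/2) F(a,b;c;r'²) / F(a,b;c;r²)`,
for `0 < r < 1`. -/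
def modulus₃ (a b c r : ℝ) : ℝ :=
  ProbabilityTheory.beta a b / 2 *
    (ordinaryHypergeometric a b c (compl r ^ 2) / ordinaryHypergeometric a b c (r ^ 2))

/-- The modular function `φ_K^{a,b,c}(r) = μ_{a,b,c}⁻¹ (μ_{a,b,c}(r) / K)`, where `μ_{a,b,c}⁻¹` is
the inverse of `μ_{a,b,c}` regarded as a function on the open interval `(0,1)`. -/
def modularPhi₃ (K a b c r : ℝ) : ℝ :=
  Function.invFunOn (modulus₃ a b c) (Set.Ioo 0 1) (modulus₃ a b c r / K)

/-- `K_{a,c} = K_{a,c-a,c}`. -/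
def ellipticK (a c r : ℝ) : ℝ := ellipticK₃ a (c - a) c r

/-- `K'_{a,c}(r) = K_{a,c}(r')`. -/
def ellipticK' (a c r : ℝ) : ℝ := ellipticK a c (compl r)

/-- `φ_K^{a,c} = φ_K^{a,c-a,c}`. -/
def modularPhi (K a c r : ℝ) : ℝ := modularPhi₃ K a (c - a) c r

/-- `f` is strictly increasing from `(0,1)` onto the set `S`. -/
def IncreasesOnto (f : ℝ → ℝ) (S : Set ℝ) : Prop :=
  StrictMonoOn f (Set.Ioo 0 1) ∧ f '' Set.Ioo 0 1 = S

/-- `f` is strictly decreasing from `(0,1)` onto the set `S`. -/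
def DecreasesOnto (f : ℝ → ℝ) (S : Set ℝ) : Prop :=
  StrictAntiOn f (Set.Ioo 0 1) ∧ f '' Set.Ioo 0 1 = S

end GenElliptic

end

open Filter Topology Set

namespace GenElliptic

/-! ### Ratios of power series -/

/-! Write F for the series, q = a(c-a), Λ = F'/F, and U(r) = log F(r²) - log F(1-r²). Since μ =
(B/2) e^{-U} and U increases from -∞ to ∞, φ_L is the translation U(φ_L(r)) = U(r) + log L. A ratio
f(s(r))/f(r) is then the exponential of the increment of G = log f over an interval of U-length log
K, and it is strictly monotone in r as soon as dG/dU is. No derivative of s is needed, only the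
Cauchy mean value theorem.

Three choices of G suffice, with x = r². For log r the quotient dG/dU is 1/(2x(Λ(x)+Λ(1-x))). For
log F(r²) it is Λ(x)/(Λ(x)+Λ(1-x)). For log r + 2 log F(1-r²) it is (1-4xΛ(1-x))/(2x(Λ(x)+Λ(1-x))).
Their monotonicity follows from three facts: Λ is strictly increasing, (1-x)Λ(x) is strictly
decreasing, and (1-x)Λ(x) ≤ q/c ≤ 1/4. The first two come from the monotone rule for quotients of
power series, the bound from comparing coefficients.

The end values come from F(0) = 1, F(1-) = ∞ and (1-x)Λ(x) → 0 at 1. This settles (1), (3) and (6).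
Because r ↦ r' changes the sign of U, s∘compl∘s = compl, which yields (2), (4) and (5) as
reciprocals; t inverts s, so (7)–(12) are reciprocals of (1)–(6). -/

theorem summable_mul_pow {p : ℕ → ℝ} {C x : ℝ} (hp : ∀ n, |p n| ≤ C * (n + 1)) (hx : |x| < 1) :
    Summable fun n => p n * x ^ n := by
  have h1 : Summable fun n : ℕ => C * ((n : ℝ) ^ 1 * |x| ^ n + |x| ^ n) :=
    ((summable_pow_mul_geometric_of_norm_lt_one 1 (by simpa using hx)).add
      (summable_geometric_of_lt_one (abs_nonneg x) hx)).mul_left C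
  refine .of_norm_bounded h1 fun n => ?_
  rw [Real.norm_eq_abs, abs_mul, abs_pow]
  calc |p n| * |x| ^ n ≤ C * (n + 1) * |x| ^ n := by gcongr; exact hp n
    _ = _ := by ring

/-- The monotone rule for quotients of power series (Biernacki and Krzyż). -/
theorem tsum_mul_tsum_lt_of_ratio_strictMono {p q : ℕ → ℝ} {x y : ℝ}
    (hpq : ∀ m n, m < n → p m * q n < p n * q m) (hx : 0 < x) (hxy : x < y)
    (hpx : Summable fun n => p n * x ^ n) (hqx : Summable fun n => q n * x ^ n)
    (hpy : Summable fun n => p n * y ^ n) (hqy : Summable fun n => q n * y ^ n) :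
    (∑' n, p n * x ^ n) * ∑' n, q n * y ^ n < (∑' n, p n * y ^ n) * ∑' n, q n * x ^ n := by
  set P := ∑' n, p n * x ^ n
  set P' := ∑' n, p n * y ^ n
  set Q := ∑' n, q n * x ^ n
  set Q' := ∑' n, q n * y ^ n
  have h1 : HasSum (fun z : ℕ × ℕ => p z.1 * y ^ z.1 * (q z.2 * x ^ z.2)) (P' * Q) :=
    hpy.hasSum.mul hqx.hasSum
      (summable_mul_of_summable_norm (f := fun n => p n * y ^ n) (g := fun n => q n * x ^ n)
        hpy.norm hqx.norm)
  have h2 : HasSum (fun z : ℕ × ℕ => p z.1 * x ^ z.1 * (q z.2 * y ^ z.2)) (P * Q') :=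
    hpx.hasSum.mul hqy.hasSum
      (summable_mul_of_summable_norm (f := fun n => p n * x ^ n) (g := fun n => q n * y ^ n)
        hpx.norm hqy.norm)
  have h1' : HasSum (fun z : ℕ × ℕ => p z.2 * y ^ z.2 * (q z.1 * x ^ z.1)) (P' * Q) :=
    ((Equiv.prodComm ℕ ℕ).hasSum_iff
      (f := fun z : ℕ × ℕ => p z.1 * y ^ z.1 * (q z.2 * x ^ z.2)) (a := P' * Q)).2 h1
  have h2' : HasSum (fun z : ℕ × ℕ => p z.2 * x ^ z.2 * (q z.1 * y ^ z.1)) (P * Q') :=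
    ((Equiv.prodComm ℕ ℕ).hasSum_iff
      (f := fun z : ℕ × ℕ => p z.1 * x ^ z.1 * (q z.2 * y ^ z.2)) (a := P * Q')).2 h2
  -- Adding the double series to its transpose turns the general term into (p m q n - p n q m)(y^m
  -- x^n - x^m y^n), whose factors always have the same sign. The index (1, 0) makes the inequality
  -- strict.
  have h := (h1.sub h2).add (h1'.sub h2')
  have key : ∀ m n : ℕ, 0 ≤ (p m * q n - p n * q m) * (y ^ m * x ^ n - x ^ m * y ^ n) ∧
      (n < m → 0 < (p m * q n - p n * q m) * (y ^ m * x ^ n - x ^ m * y ^ n)) := by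
    have pos : ∀ m n : ℕ, n < m →
        0 < (p m * q n - p n * q m) * (y ^ m * x ^ n - x ^ m * y ^ n) := by
      intro m n hnm
      obtain ⟨k, rfl⟩ := Nat.exists_eq_add_of_lt hnm
      have hk : x ^ (k + 1) < y ^ (k + 1) := pow_lt_pow_left₀ hxy hx.le (by simp)
      have hxn : 0 < x ^ n * y ^ n := mul_pos (pow_pos hx n) (pow_pos (hx.trans hxy) n)
      refine mul_pos (sub_pos.2 (hpq _ _ hnm)) ?_
      have : y ^ (n + k + 1) * x ^ n - x ^ (n + k + 1) * y ^ n
          = x ^ n * y ^ n * (y ^ (k + 1) - x ^ (k + 1)) := by ring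
      rw [this]
      exact mul_pos hxn (sub_pos.2 hk)
    intro m n
    refine ⟨?_, pos m n⟩
    rcases lt_trichotomy n m with h | rfl | h
    · exact (pos m n h).le
    · simp
    · refine (pos n m h).le.trans (le_of_eq (by ring))
  have hpos : 0 < P' * Q - P * Q' + (P' * Q - P * Q') := by
    refine hasSum_lt (i := ((1 : ℕ), (0 : ℕ))) (f := fun _ => (0 : ℝ)) (fun z => ?_) ?_
      hasSum_zero h
    · refine (key z.1 z.2).1.trans (le_of_eq ?_)
      ring
    · refine ((key 1 0).2 one_pos).trans_le (le_of_eq ?_)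
      ring
  linarith

/-! ### The zero-balanced hypergeometric series -/

/-- The Taylor coefficients of `F(a,b;a+b;x)`, in terms of `q = a b` and `c = a + b`. -/
noncomputable def zbCoeff (q c : ℝ) : ℕ → ℝ
  | 0 => 1
  | n + 1 => zbCoeff q c n * (n + q / (c + n)) / (n + 1)

/-- `F(a,b;a+b;x)`, in terms of `q = a b` and `c = a + b`. -/
noncomputable def zb (q c x : ℝ) : ℝ := ∑' n, zbCoeff q c n * x ^ n

/-- The derivative of `zb q c` on `(-1,1)`. -/
noncomputable def zbDeriv (q c x : ℝ) : ℝ :=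
  ∑' n : ℕ, zbCoeff q c n * (n + q / (c + n)) * x ^ n

/-- The logarithmic derivative of `zb q c`. -/
noncomputable def zbLogDeriv (q c x : ℝ) : ℝ := zbDeriv q c x / zb q c x

section Series

variable {q c : ℝ}

theorem zbCoeff_succ_mul (n : ℕ) :
    zbCoeff q c (n + 1) * ((n : ℝ) + 1) = zbCoeff q c n * (n + q / (c + n)) := by
  rw [zbCoeff]
  field_simp

theorem zbCoeff_pos (hq : 0 < q) (hc : 0 < c) (n : ℕ) : 0 < zbCoeff q c n := by
  induction n with
  | zero => simp [zbCoeff]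
  | succ n ih => rw [zbCoeff]; positivity

theorem div_add_le_one (hc : 0 < c) (hqc : q ≤ c) (n : ℕ) :
    q / (c + n) ≤ 1 := by
  have : (0 : ℝ) ≤ n := n.cast_nonneg
  rw [div_le_one (by positivity)]
  linarith

theorem zbCoeff_le_one (hq : 0 < q) (hc : 0 < c) (hqc : q ≤ c) (n : ℕ) :
    zbCoeff q c n ≤ 1 := by
  induction n with
  | zero => simp [zbCoeff]
  | succ n ih =>
    have h1 := div_add_le_one hc hqc n
    have h2 := zbCoeff_pos hq hc n
    rw [zbCoeff, div_le_one (by positivity)]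
    have : (0 : ℝ) ≤ n + q / (c + n) := by positivity
    nlinarith

theorem summable_zb (hq : 0 < q) (hc : 0 < c) (hqc : q ≤ c) {x : ℝ} (hx : |x| < 1) :
    Summable fun n => zbCoeff q c n * x ^ n := by
  refine summable_mul_pow (C := 1) (fun n => ?_) hx
  rw [abs_of_pos (zbCoeff_pos hq hc n)]
  have : (0 : ℝ) ≤ n := n.cast_nonneg
  linarith [zbCoeff_le_one hq hc hqc n]

theorem summable_zbDeriv (hq : 0 < q) (hc : 0 < c) (hqc : q ≤ c) {x : ℝ} (hx : |x| < 1) :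
    Summable fun n : ℕ => zbCoeff q c n * (n + q / (c + n)) * x ^ n := by
  refine summable_mul_pow (C := 1) (fun n => ?_) hx
  have h1 := zbCoeff_pos hq hc n
  have h2 : (0 : ℝ) ≤ n + q / (c + n) := by positivity
  rw [abs_of_nonneg (by positivity)]
  have := div_add_le_one hc hqc n
  exact mul_le_mul (zbCoeff_le_one hq hc hqc n) (by linarith) h2 zero_le_one

theorem summable_zbCoeff_div (hq : 0 < q) (hc : 0 < c) (hqc : q ≤ c) {x : ℝ} (hx : |x| < 1) :
    Summable fun n : ℕ => zbCoeff q c n * (q / (c + n)) * x ^ n := by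
  refine summable_mul_pow (C := 1) (fun n => ?_) hx
  have h1 := zbCoeff_pos hq hc n
  rw [abs_of_nonneg (by positivity)]
  have := div_add_le_one hc hqc n
  have : (0 : ℝ) ≤ n := n.cast_nonneg
  exact mul_le_mul (zbCoeff_le_one hq hc hqc n) (by linarith) (by positivity) zero_le_one

theorem one_le_zb (hq : 0 < q) (hc : 0 < c) (hqc : q ≤ c) {x : ℝ} (h0 : 0 ≤ x) (h1 : x < 1) :
    1 ≤ zb q c x := by
  have := (summable_zb hq hc hqc (abs_lt.2 ⟨by linarith, h1⟩)).le_tsum 0 fun n _ =>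
    mul_nonneg (zbCoeff_pos hq hc n).le (pow_nonneg h0 n)
  simpa [zbCoeff, zb] using this

theorem zb_zero : zb q c 0 = 1 := by
  rw [zb, tsum_eq_single 0 fun n hn => by simp [hn]]
  simp [zbCoeff]

theorem hasDerivAt_zb (hq : 0 < q) (hc : 0 < c) (hqc : q ≤ c) {x : ℝ} (hx : |x| < 1) :
    HasDerivAt (zb q c) (zbDeriv q c x) x := by
  obtain ⟨ρ, hxρ, hρ1⟩ := exists_between hx
  have hρ0 : 0 < ρ := (abs_nonneg x).trans_lt hxρ
  have hsum : Summable fun n : ℕ => (n : ℝ) * ρ ^ (n - 1) := by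
    rw [← summable_nat_add_iff 1]
    refine (summable_mul_pow (p := fun n => (n : ℝ) + 1) (C := 1) (fun n => ?_)
      (x := ρ) (by rwa [abs_of_pos hρ0])).congr fun n => by simp
    rw [abs_of_nonneg (by positivity), one_mul]
  have h := hasDerivAt_tsum_of_isPreconnected (g := fun n x => zbCoeff q c n * x ^ n)
    (g' := fun n x => zbCoeff q c n * (n * x ^ (n - 1))) (t := Ioo (-ρ) ρ) (y₀ := x) (y := x)
    hsum isOpen_Ioo isPreconnected_Ioo (fun n y _ => (hasDerivAt_pow n y).const_mul _)
    (fun n y hy => ?_) (abs_lt.1 hxρ) (summable_zb hq hc hqc hx) (abs_lt.1 hxρ)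
  · convert! h using 1
    have hs : Summable fun n : ℕ => zbCoeff q c n * (n * x ^ (n - 1)) := by
      rw [← summable_nat_add_iff 1]
      refine (summable_zbDeriv hq hc hqc hx).congr fun n => ?_
      rw [← zbCoeff_succ_mul]
      push_cast
      ring
    rw [hs.tsum_eq_zero_add, zbDeriv]
    simp only [Nat.cast_zero, zero_mul, mul_zero, zero_add]
    refine tsum_congr fun n => ?_
    rw [← zbCoeff_succ_mul]
    push_cast
    ring
  · have hpos := zbCoeff_pos hq hc n
    have hle := zbCoeff_le_one hq hc hqc n
    rw [Real.norm_eq_abs, abs_mul, abs_mul, abs_pow, abs_of_pos hpos, Nat.abs_cast]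
    calc zbCoeff q c n * (n * |y| ^ (n - 1)) ≤ 1 * (n * ρ ^ (n - 1)) := by
          gcongr
          exact (abs_lt.2 hy).le
      _ = _ := one_mul _

/-- With A_n for `zbCoeff q c n`, the coefficient of x^n is (n+1)A_{n+1} = A_n(n + q/(c+n)) in F'
and n A_n in xF'; the terms n A_n cancel. -/
theorem one_sub_mul_zbDeriv (hq : 0 < q) (hc : 0 < c) (hqc : q ≤ c) {x : ℝ} (hx : |x| < 1) :
    (1 - x) * zbDeriv q c x = ∑' n : ℕ, zbCoeff q c n * (q / (c + n)) * x ^ n := by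
  have hd := summable_zbDeriv hq hc hqc hx
  have he := summable_zbCoeff_div hq hc hqc hx
  have hn : HasSum (fun n : ℕ => zbCoeff q c n * n * x ^ n) (x * zbDeriv q c x) := by
    rw [← hasSum_nat_add_iff' 1]
    simp only [Finset.range_one, Finset.sum_singleton, Nat.cast_zero, mul_zero, zero_mul, sub_zero]
    refine (hd.hasSum.mul_left x).congr_fun fun n => ?_
    rw [← zbCoeff_succ_mul]
    push_cast
    ring
  have h := hn.add he.hasSum
  have h2 : zbDeriv q c x = x * zbDeriv q c x
      + ∑' n : ℕ, zbCoeff q c n * (q / (c + n)) * x ^ n := by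
    refine hd.hasSum.unique (h.congr_fun fun n => ?_)
    ring
  linarith

end Series

/-! ### Monotonicity and boundary behaviour of Λ = F'/F -/

section LogDeriv

variable {q c : ℝ}

theorem zb_pos (hq : 0 < q) (hc : 0 < c) (hqc : q ≤ c) {x : ℝ} (h0 : 0 ≤ x) (h1 : x < 1) :
    0 < zb q c x :=
  one_pos.trans_le (one_le_zb hq hc hqc h0 h1)

theorem zbDeriv_pos (hq : 0 < q) (hc : 0 < c) (hqc : q ≤ c) {x : ℝ} (h0 : 0 ≤ x) (h1 : x < 1) :
    0 < zbDeriv q c x := by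
  have := (summable_zbDeriv hq hc hqc (abs_lt.2 ⟨by linarith, h1⟩)).le_tsum 0 fun n _ =>
    mul_nonneg (mul_nonneg (zbCoeff_pos hq hc n).le (by positivity)) (pow_nonneg h0 n)
  refine lt_of_lt_of_le ?_ this
  simp only [zbCoeff, Nat.cast_zero]
  positivity

theorem zbLogDeriv_pos (hq : 0 < q) (hc : 0 < c) (hqc : q ≤ c) {x : ℝ} (h0 : 0 ≤ x)
    (h1 : x < 1) : 0 < zbLogDeriv q c x :=
  div_pos (zbDeriv_pos hq hc hqc h0 h1) (zb_pos hq hc hqc h0 h1)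

/-- The coefficients of F' and F have ratio n + q/(c+n), with increments 1 - q/((c+n)(c+n+1)); these
are positive because q < c(c+1). -/
theorem zbLogDeriv_strictMonoOn (hq : 0 < q) (hc : 0 < c) (hqc : q ≤ c)
    (hqc' : q < c * (c + 1)) : StrictMonoOn (zbLogDeriv q c) (Ioo 0 1) := by
  have step : StrictMono fun n : ℕ => (n : ℝ) + q / (c + n) := by
    refine strictMono_nat_of_lt_succ fun n => ?_
    have hn : (0 : ℝ) ≤ n := n.cast_nonneg
    have e : ((n + 1 : ℕ) : ℝ) + q / (c + (n + 1 : ℕ)) - (n + q / (c + n))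
        = ((c + n) * (c + n + 1) - q) / ((c + n) * (c + n + 1)) := by
      push_cast
      have : c + ((n : ℝ) + 1) ≠ 0 := by positivity
      field_simp
      ring
    have : 0 < ((c + n) * (c + n + 1) - q) / ((c + n) * (c + n + 1)) :=
      div_pos (by nlinarith) (by positivity)
    linarith
  intro x hx y hy hxy
  have hx' : |x| < 1 := abs_lt.2 ⟨by linarith [hx.1], hx.2⟩
  have hy' : |y| < 1 := abs_lt.2 ⟨by linarith [hy.1], hy.2⟩
  rw [zbLogDeriv, zbLogDeriv, div_lt_div_iff₀ (zb_pos hq hc hqc hx.1.le hx.2)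
    (zb_pos hq hc hqc hy.1.le hy.2)]
  refine tsum_mul_tsum_lt_of_ratio_strictMono (fun m n hmn => ?_) hx.1 hxy
    (summable_zbDeriv hq hc hqc hx') (summable_zb hq hc hqc hx')
    (summable_zbDeriv hq hc hqc hy') (summable_zb hq hc hqc hy')
  have := mul_lt_mul_of_pos_left (step hmn)
    (mul_pos (zbCoeff_pos hq hc m) (zbCoeff_pos hq hc n))
  dsimp only at this
  linarith

/-- The coefficients of (1-x)F' and F have ratio q/(c+n), which decreases; the quotient rule is
applied with F as numerator. -/
theorem one_sub_mul_zbLogDeriv_strictAntiOn (hq : 0 < q) (hc : 0 < c) (hqc : q ≤ c) :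
    StrictAntiOn (fun x => (1 - x) * zbLogDeriv q c x) (Ioo 0 1) := by
  have step : StrictAnti fun n : ℕ => q / (c + n) := fun m n hmn => by
    have : (m : ℝ) < n := Nat.cast_lt.2 hmn
    have hm : (0 : ℝ) ≤ m := m.cast_nonneg
    exact div_lt_div_of_pos_left hq (by positivity) (by linarith)
  intro x hx y hy hxy
  have hx' : |x| < 1 := abs_lt.2 ⟨by linarith [hx.1], hx.2⟩
  have hy' : |y| < 1 := abs_lt.2 ⟨by linarith [hy.1], hy.2⟩
  simp only [zbLogDeriv, ← mul_div_assoc]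
  rw [one_sub_mul_zbDeriv hq hc hqc hx', one_sub_mul_zbDeriv hq hc hqc hy',
    div_lt_div_iff₀ (zb_pos hq hc hqc hy.1.le hy.2) (zb_pos hq hc hqc hx.1.le hx.2),
    mul_comm, mul_comm _ (zb q c y)]
  rw [mul_comm (zb q c y), mul_comm (zb q c x)]
  have := tsum_mul_tsum_lt_of_ratio_strictMono (p := zbCoeff q c)
    (q := fun n => zbCoeff q c n * (q / (c + n))) (fun m n hmn => ?_) hx.1 hxy
    (summable_zb hq hc hqc hx') (summable_zbCoeff_div hq hc hqc hx')
    (summable_zb hq hc hqc hy') (summable_zbCoeff_div hq hc hqc hy')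
  · unfold zb
    linarith
  · have := mul_lt_mul_of_pos_left (step hmn)
      (mul_pos (zbCoeff_pos hq hc m) (zbCoeff_pos hq hc n))
    dsimp only at this
    linarith

theorem one_sub_mul_zbLogDeriv_le (hq : 0 < q) (hc : 0 < c) (hqc : q ≤ c) {x : ℝ}
    (h0 : 0 ≤ x) (h1 : x < 1) : (1 - x) * zbLogDeriv q c x ≤ q / c := by
  have hx : |x| < 1 := abs_lt.2 ⟨by linarith, h1⟩
  rw [zbLogDeriv, ← mul_div_assoc, one_sub_mul_zbDeriv hq hc hqc hx,
    div_le_iff₀ (zb_pos hq hc hqc h0 h1), zb, ← tsum_mul_left]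
  refine (summable_zbCoeff_div hq hc hqc hx).tsum_le_tsum (fun n => ?_)
    ((summable_zb hq hc hqc hx).mul_left _)
  have h2 := zbCoeff_pos hq hc n
  have h3 : q / (c + n) ≤ q / c :=
    div_le_div_of_nonneg_left hq.le hc (by linarith [n.cast_nonneg (α := ℝ)])
  calc zbCoeff q c n * (q / (c + n)) * x ^ n ≤ zbCoeff q c n * (q / c) * x ^ n := by gcongr
    _ = _ := by ring

/-- The sequence n A_n is nondecreasing for n ≥ 1 and starts at q/c. So A_n dominates a multiple of
1/n, and F is unbounded near 1. -/
theorem le_zbCoeff_succ_mul (hq : 0 < q) (hc : 0 < c) (n : ℕ) :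
    q / c ≤ zbCoeff q c (n + 1) * ((n : ℝ) + 1) := by
  induction n with
  | zero => simp [zbCoeff]
  | succ n ih =>
    rw [zbCoeff_succ_mul]
    refine ih.trans (mul_le_mul_of_nonneg_left ?_ (zbCoeff_pos hq hc _).le)
    push_cast
    have : 0 ≤ q / (c + (n + 1)) := by positivity
    linarith

theorem not_summable_zbCoeff (hq : 0 < q) (hc : 0 < c) : ¬ Summable (zbCoeff q c) := by
  intro h
  have h1 : Summable fun n : ℕ => q / c * (1 / ((n : ℝ) + 1)) := by
    refine ((summable_nat_add_iff 1).2 h).of_nonneg_of_le (fun n => by positivity) fun n => ?_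
    rw [mul_one_div, div_le_iff₀ (by positivity)]
    exact le_zbCoeff_succ_mul hq hc n
  rw [summable_mul_left_iff (by positivity)] at h1
  refine Real.not_summable_one_div_natCast ((summable_nat_add_iff 1).1 ?_)
  simpa using h1

theorem tendsto_zb_atTop (hq : 0 < q) (hc : 0 < c) (hqc : q ≤ c) :
    Tendsto (zb q c) (𝓝[<] 1) atTop := by
  refine tendsto_atTop.2 fun M => ?_
  have h1 := (not_summable_iff_tendsto_nat_atTop_of_nonneg
    fun n => (zbCoeff_pos hq hc n).le).1 (not_summable_zbCoeff hq hc)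
  obtain ⟨N, hN⟩ := (h1.eventually_gt_atTop M).exists
  have hcont : Continuous fun x : ℝ => ∑ n ∈ Finset.range N, zbCoeff q c n * x ^ n := by fun_prop
  have h2 : ∀ᶠ x in 𝓝 (1 : ℝ), M < ∑ n ∈ Finset.range N, zbCoeff q c n * x ^ n :=
    hcont.continuousAt.eventually (lt_mem_nhds (by simpa using hN))
  filter_upwards [nhdsWithin_le_nhds h2, Ioo_mem_nhdsLT (zero_lt_one' ℝ)] with x hx hx1
  exact hx.le.trans ((summable_zb hq hc hqc (abs_lt.2 ⟨by linarith [hx1.1], hx1.2⟩)).sum_le_tsum _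
    fun n _ => mul_nonneg (zbCoeff_pos hq hc n).le (pow_nonneg hx1.1.le n))

/-- The quotient is an average of the weights q/(c+n) with masses A_n x^n. The weights tend to 0,
and any finite block of mass is negligible because F → ∞. -/
theorem tendsto_one_sub_mul_zbLogDeriv (hq : 0 < q) (hc : 0 < c) (hqc : q ≤ c) :
    Tendsto (fun x => (1 - x) * zbLogDeriv q c x) (𝓝[<] 1) (𝓝 0) := by
  have hev : ∀ᶠ x : ℝ in 𝓝[<] 1, x ∈ Ioo (0 : ℝ) 1 := Ioo_mem_nhdsLT (zero_lt_one' ℝ)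
  refine tendsto_order.2 ⟨fun b hb => ?_, fun ε hε => ?_⟩
  · filter_upwards [hev] with x hx
    exact hb.trans (mul_pos (sub_pos.2 hx.2) (zbLogDeriv_pos hq hc hqc hx.1.le hx.2))
  obtain ⟨N, hN⟩ := exists_nat_gt (q / (ε / 2))
  have h1 : Tendsto (fun x => N / zb q c x) (𝓝[<] 1) (𝓝 0) :=
    (tendsto_zb_atTop hq hc hqc).const_div_atTop _
  filter_upwards [hev, h1.eventually (gt_mem_nhds (half_pos hε))] with x hx hx2
  have hxa : |x| < 1 := abs_lt.2 ⟨by linarith [hx.1], hx.2⟩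
  have hz := zb_pos hq hc hqc hx.1.le hx.2
  -- Majorant: each of the first N terms is at most 1, and beyond N the weight q/(c+n) is at most
  -- ε/2 by the choice of N.
  have hs : HasSum (fun n => ite (n ∈ Finset.range N) (1 : ℝ) 0 + ε / 2 * (zbCoeff q c n * x ^ n))
      (∑ n ∈ Finset.range N, ite (n ∈ Finset.range N) (1 : ℝ) 0 + ε / 2 * zb q c x) :=
    (hasSum_sum_of_ne_finset_zero fun n hn => by simp [hn]).add
      ((summable_zb hq hc hqc hxa).hasSum.mul_left _)
  have hle := hasSum_le (fun n => ?_) (summable_zbCoeff_div hq hc hqc hxa).hasSum hs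
  · rw [← one_sub_mul_zbDeriv hq hc hqc hxa] at hle
    rw [zbLogDeriv, ← mul_div_assoc, div_lt_iff₀ hz]
    rw [div_lt_iff₀ hz] at hx2
    have : ∑ n ∈ Finset.range N, ite (n ∈ Finset.range N) (1 : ℝ) 0 = N := by
      rw [Finset.sum_congr rfl fun n hn => if_pos hn]
      simp
    linarith
  · have hA := zbCoeff_pos hq hc n
    have hxn : x ^ n ≤ 1 := pow_le_one₀ hx.1.le hx.2.le
    have hxn0 : 0 < x ^ n := pow_pos hx.1 n
    split_ifs with hn
    · have h3 : zbCoeff q c n * (q / (c + n)) * x ^ n ≤ 1 * 1 * 1 := by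
        gcongr
        · exact zbCoeff_le_one hq hc hqc n
        · exact div_add_le_one hc hqc n
      have : 0 ≤ ε / 2 * (zbCoeff q c n * x ^ n) := by positivity
      linarith
    · have hNn : (N : ℝ) ≤ n := by exact_mod_cast (by simpa using hn : N ≤ n)
      have h3 : q / (c + n) ≤ ε / 2 := by
        rw [div_lt_iff₀ (by positivity)] at hN
        rw [div_le_iff₀ (by positivity)]
        nlinarith
      calc zbCoeff q c n * (q / (c + n)) * x ^ n ≤ zbCoeff q c n * (ε / 2) * x ^ n := by gcongr
        _ = _ := by ring

theorem tendsto_mul_zbLogDeriv (hq : 0 < q) (hc : 0 < c) (hqc : q ≤ c) :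
    Tendsto (fun x => x * zbLogDeriv q c x) (𝓝[>] 0) (𝓝 0) := by
  have hcont : ContinuousAt (fun x : ℝ => x * (q / c / (1 - x))) 0 := by
    refine continuousAt_id.mul (continuousAt_const.div (by fun_prop) (by norm_num))
  have h1 : Tendsto (fun x : ℝ => x * (q / c / (1 - x))) (𝓝[>] 0) (𝓝 0) := by
    simpa using hcont.tendsto.mono_left nhdsWithin_le_nhds
  refine tendsto_of_tendsto_of_tendsto_of_le_of_le' tendsto_const_nhds h1 ?_ ?_
  · filter_upwards [Ioo_mem_nhdsGT (zero_lt_one' ℝ)] with x hx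
    exact mul_nonneg hx.1.le (zbLogDeriv_pos hq hc hqc hx.1.le hx.2).le
  · filter_upwards [Ioo_mem_nhdsGT (zero_lt_one' ℝ)] with x hx
    refine mul_le_mul_of_nonneg_left ?_ hx.1.le
    rw [le_div_iff₀ (sub_pos.2 hx.2), mul_comm]
    exact one_sub_mul_zbLogDeriv_le hq hc hqc hx.1.le hx.2

end LogDeriv

/-- Zero balance gives (a+n)(c-a+n) = n(c+n) + a(c-a), so a enters the coefficient recursion only
through the product a(c-a). -/
theorem ordinaryHypergeometric_eq_zb {a c : ℝ} (hc : 0 < c) (x : ℝ) :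
    ordinaryHypergeometric a (c - a) c x = zb (a * (c - a)) c x := by
  rw [ordinaryHypergeometric_eq_tsum, zb]
  refine tsum_congr fun n => ?_
  rw [smul_eq_mul]
  congr 1
  induction n with
  | zero => simp [zbCoeff]
  | succ n ih =>
    have h1 : (ascPochhammer ℝ n).eval c ≠ 0 := (ascPochhammer_pos n c hc).ne'
    have h2 : c + n ≠ 0 := by positivity
    rw [zbCoeff, ← ih, ascPochhammer_succ_eval, ascPochhammer_succ_eval, ascPochhammer_succ_eval,
      Nat.factorial_succ]
    push_cast
    field_simp
    ring

/-! ### Monotone maps of the unit interval -/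

theorem isPreconnected_unitIoo : IsPreconnected (Ioo (0 : ℝ) 1) := isPreconnected_Ioo

theorem eventually_mem_unitIoo_zero : ∀ᶠ x : ℝ in 𝓝[>] 0, x ∈ Ioo (0 : ℝ) 1 :=
  Ioo_mem_nhdsGT (zero_lt_one' ℝ)

theorem eventually_mem_unitIoo_one : ∀ᶠ x : ℝ in 𝓝[<] 1, x ∈ Ioo (0 : ℝ) 1 :=
  Ioo_mem_nhdsLT (zero_lt_one' ℝ)

theorem decreasesOnto_Ioi {f : ℝ → ℝ} {l : ℝ} (hf : StrictAntiOn f (Ioo 0 1))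
    (hc : ContinuousOn f (Ioo 0 1)) (h0 : Tendsto f (𝓝[>] 0) atTop)
    (h1 : Tendsto f (𝓝[<] 1) (𝓝 l)) : DecreasesOnto f (Ioi l) := by
  refine ⟨hf, Subset.antisymm ?_ (isPreconnected_unitIoo.intermediate_value_Ioi
    (le_principal_iff.2 eventually_mem_unitIoo_one)
    (le_principal_iff.2 eventually_mem_unitIoo_zero) hc h1 h0)⟩
  rintro _ ⟨x, hx, rfl⟩
  obtain ⟨y, hxy, hy⟩ := exists_between hx.2
  have hyI : y ∈ Ioo (0 : ℝ) 1 := ⟨hx.1.trans hxy, hy⟩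
  refine lt_of_le_of_lt (le_of_tendsto h1 ?_) (hf hx hyI hxy)
  filter_upwards [Ioo_mem_nhdsLT hy] with z hz
  exact (hf hyI ⟨hyI.1.trans hz.1, hz.2⟩ hz.1).le

theorem increasesOnto_Ioo {f : ℝ → ℝ} {l m : ℝ} (hf : StrictMonoOn f (Ioo 0 1))
    (hc : ContinuousOn f (Ioo 0 1)) (h0 : Tendsto f (𝓝[>] 0) (𝓝 l))
    (h1 : Tendsto f (𝓝[<] 1) (𝓝 m)) : IncreasesOnto f (Ioo l m) := by
  refine ⟨hf, Subset.antisymm ?_ (isPreconnected_unitIoo.intermediate_value_Ioo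
    (le_principal_iff.2 eventually_mem_unitIoo_zero)
    (le_principal_iff.2 eventually_mem_unitIoo_one) hc h0 h1)⟩
  rintro _ ⟨x, hx, rfl⟩
  constructor
  · obtain ⟨y, hy, hxy⟩ := exists_between hx.1
    have hyI : y ∈ Ioo (0 : ℝ) 1 := ⟨hy, hxy.trans hx.2⟩
    refine lt_of_le_of_lt (le_of_tendsto h0 ?_) (hf hyI hx hxy)
    filter_upwards [Ioo_mem_nhdsGT hy] with z hz
    exact (hf ⟨hz.1, hz.2.trans hyI.2⟩ hyI hz.2).le
  · obtain ⟨y, hxy, hy⟩ := exists_between hx.2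
    have hyI : y ∈ Ioo (0 : ℝ) 1 := ⟨hx.1.trans hxy, hy⟩
    refine lt_of_lt_of_le (hf hx hyI hxy) (ge_of_tendsto h1 ?_)
    filter_upwards [Ioo_mem_nhdsLT hy] with z hz
    exact (hf hyI ⟨hyI.1.trans hz.1, hz.2⟩ hz.1).le

section

variable {e f g : ℝ → ℝ} {T : Set ℝ}

theorem IncreasesOnto.mem (h : IncreasesOnto f T) {r : ℝ} (hr : r ∈ Ioo (0 : ℝ) 1) : f r ∈ T :=
  h.2 ▸ mem_image_of_mem f hr

theorem DecreasesOnto.mem (h : DecreasesOnto f T) {r : ℝ} (hr : r ∈ Ioo (0 : ℝ) 1) : f r ∈ T :=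
  h.2 ▸ mem_image_of_mem f hr

theorem image_eq_inv_of_image_comp (he : e '' Ioo 0 1 = Ioo 0 1) (hf : f '' Ioo 0 1 = T)
    (hg : ∀ r ∈ Ioo (0 : ℝ) 1, g r = (f (e r))⁻¹) : g '' Ioo 0 1 = T⁻¹ := by
  rw [image_congr hg, ← hf, ← image_inv_eq_inv]
  conv_rhs => rw [← he]
  rw [image_image, image_image]

/-- This and its three variants serve with e = t and e = compl∘s, which turn one ratio into the
reciprocal of another. `T⁻¹` is the pointwise inverse of the set. -/
theorem IncreasesOnto.inv_comp_increasing (hf : IncreasesOnto f T) (hT : T ⊆ Ioi 0)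
    (he : IncreasesOnto e (Ioo 0 1)) (hg : ∀ r ∈ Ioo (0 : ℝ) 1, g r = (f (e r))⁻¹) :
    DecreasesOnto g T⁻¹ := by
  refine ⟨fun x hx y hy hxy => ?_, image_eq_inv_of_image_comp he.2 hf.2 hg⟩
  rw [hg x hx, hg y hy]
  exact inv_strictAnti₀ (hT (hf.mem (he.mem hx))) (hf.1 (he.mem hx) (he.mem hy) (he.1 hx hy hxy))

theorem IncreasesOnto.inv_comp_decreasing (hf : IncreasesOnto f T) (hT : T ⊆ Ioi 0)
    (he : DecreasesOnto e (Ioo 0 1)) (hg : ∀ r ∈ Ioo (0 : ℝ) 1, g r = (f (e r))⁻¹) :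
    IncreasesOnto g T⁻¹ := by
  refine ⟨fun x hx y hy hxy => ?_, image_eq_inv_of_image_comp he.2 hf.2 hg⟩
  rw [hg x hx, hg y hy]
  exact inv_strictAnti₀ (hT (hf.mem (he.mem hy))) (hf.1 (he.mem hy) (he.mem hx) (he.1 hx hy hxy))

theorem DecreasesOnto.inv_comp_increasing (hf : DecreasesOnto f T) (hT : T ⊆ Ioi 0)
    (he : IncreasesOnto e (Ioo 0 1)) (hg : ∀ r ∈ Ioo (0 : ℝ) 1, g r = (f (e r))⁻¹) :
    IncreasesOnto g T⁻¹ := by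
  refine ⟨fun x hx y hy hxy => ?_, image_eq_inv_of_image_comp he.2 hf.2 hg⟩
  rw [hg x hx, hg y hy]
  exact inv_strictAnti₀ (hT (hf.mem (he.mem hy))) (hf.1 (he.mem hx) (he.mem hy) (he.1 hx hy hxy))

theorem DecreasesOnto.inv_comp_decreasing (hf : DecreasesOnto f T) (hT : T ⊆ Ioi 0)
    (he : DecreasesOnto e (Ioo 0 1)) (hg : ∀ r ∈ Ioo (0 : ℝ) 1, g r = (f (e r))⁻¹) :
    DecreasesOnto g T⁻¹ := by
  refine ⟨fun x hx y hy hxy => ?_, image_eq_inv_of_image_comp he.2 hf.2 hg⟩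
  rw [hg x hx, hg y hy]
  exact inv_strictAnti₀ (hT (hf.mem (he.mem hx))) (hf.1 (he.mem hy) (he.mem hx) (he.1 hx hy hxy))

theorem IncreasesOnto.continuousOn (he : IncreasesOnto e (Ioo 0 1)) :
    ContinuousOn e (Ioo 0 1) := fun _ hx =>
  (he.1.continuousAt_of_image_mem_nhds (isOpen_Ioo.mem_nhds hx)
    (he.2.symm ▸ isOpen_Ioo.mem_nhds (he.mem hx))).continuousWithinAt

theorem IncreasesOnto.tendsto_zero (he : IncreasesOnto e (Ioo 0 1)) :
    Tendsto e (𝓝[>] 0) (𝓝[>] 0) := by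
  refine tendsto_nhdsWithin_iff.2 ⟨tendsto_order.2 ⟨fun b hb => ?_, fun ε hε => ?_⟩, ?_⟩
  · filter_upwards [eventually_mem_unitIoo_zero] with x hx
    exact hb.trans (he.mem hx).1
  · obtain ⟨δ, hδ0, hδ⟩ := exists_between (lt_min hε (zero_lt_one' ℝ))
    obtain ⟨x, hx, hxe⟩ : δ ∈ e '' Ioo 0 1 := he.2.symm ▸ ⟨hδ0, hδ.trans_le (min_le_right _ _)⟩
    filter_upwards [Ioo_mem_nhdsGT hx.1] with y hy
    exact (he.1 ⟨hy.1, hy.2.trans hx.2⟩ hx hy.2).trans (hxe ▸ hδ.trans_le (min_le_left _ _))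
  · filter_upwards [eventually_mem_unitIoo_zero] with x hx
    exact (he.mem hx).1

theorem IncreasesOnto.tendsto_one (he : IncreasesOnto e (Ioo 0 1)) :
    Tendsto e (𝓝[<] 1) (𝓝[<] 1) := by
  refine tendsto_nhdsWithin_iff.2 ⟨tendsto_order.2 ⟨fun b hb => ?_, fun b hb => ?_⟩, ?_⟩
  · obtain ⟨δ, hδ, hδ1⟩ := exists_between (max_lt hb (zero_lt_one' ℝ))
    obtain ⟨x, hx, hxe⟩ : δ ∈ e '' Ioo 0 1 :=
      he.2.symm ▸ ⟨(le_max_right _ _).trans_lt hδ, hδ1⟩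
    filter_upwards [Ioo_mem_nhdsLT hx.2] with y hy
    exact ((le_max_left b 0).trans_lt (hxe ▸ hδ)).trans (he.1 hx ⟨hx.1.trans hy.1, hy.2⟩ hy.1)
  · filter_upwards [eventually_mem_unitIoo_one] with x hx
    exact (he.mem hx).2.trans hb
  · filter_upwards [eventually_mem_unitIoo_one] with x hx
    exact (he.mem hx).2

end

/-! ### Increments along a shift -/

section Shift

variable {U G u g σ : ℝ → ℝ} {k : ℝ}

theorem exists_sub_eq_div_mul (hU : ∀ x ∈ Ioo (0 : ℝ) 1, HasDerivAt U (u x) x)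
    (hu : ∀ x ∈ Ioo (0 : ℝ) 1, 0 < u x) (hG : ∀ x ∈ Ioo (0 : ℝ) 1, HasDerivAt G (g x) x)
    {x y : ℝ} (hx : x ∈ Ioo (0 : ℝ) 1) (hy : y ∈ Ioo (0 : ℝ) 1) (hxy : x < y) :
    ∃ z ∈ Ioo x y, G y - G x = g z / u z * (U y - U x) := by
  have hsub : Icc x y ⊆ Ioo 0 1 := fun z hz => ⟨hx.1.trans_le hz.1, hz.2.trans_lt hy.2⟩
  obtain ⟨z, hz, h⟩ := exists_ratio_hasDerivAt_eq_ratio_slope U u hxy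
    (fun z hz => (hU z (hsub hz)).continuousAt.continuousWithinAt)
    (fun z hz => hU z (hsub (Ioo_subset_Icc_self hz))) G g
    (fun z hz => (hG z (hsub hz)).continuousAt.continuousWithinAt)
    (fun z hz => hG z (hsub (Ioo_subset_Icc_self hz)))
  have := hu z (hsub (Ioo_subset_Icc_self hz))
  refine ⟨z, hz, ?_⟩
  field_simp
  linarith

theorem strictMonoOn_of_hasDerivAt_pos (hU : ∀ x ∈ Ioo (0 : ℝ) 1, HasDerivAt U (u x) x)
    (hu : ∀ x ∈ Ioo (0 : ℝ) 1, 0 < u x) : StrictMonoOn U (Ioo 0 1) := by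
  refine strictMonoOn_of_deriv_pos (convex_Ioo 0 1)
    (fun x hx => (hU x hx).continuousAt.continuousWithinAt) fun x hx => ?_
  rw [interior_Ioo] at hx
  rw [(hU x hx).deriv]
  exact hu x hx

/-- The intervals [x, σ x] and [y, σ y] have the same U-length k, and by Cauchy's mean value theorem
the increment of G is k times a value of g/u inside. Those inner points are certainly ordered only
when the intervals do not overlap. -/
theorem strictMonoOn_sub_of_strictMonoOn_div
    (hU : ∀ x ∈ Ioo (0 : ℝ) 1, HasDerivAt U (u x) x)
    (hu : ∀ x ∈ Ioo (0 : ℝ) 1, 0 < u x) (hG : ∀ x ∈ Ioo (0 : ℝ) 1, HasDerivAt G (g x) x)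
    (hh : StrictMonoOn (fun x => g x / u x) (Ioo 0 1))
    (hσ : ∀ x ∈ Ioo (0 : ℝ) 1, σ x ∈ Ioo (0 : ℝ) 1 ∧ U (σ x) = U x + k) (hk : 0 < k) :
    StrictMonoOn (fun x => G (σ x) - G x) (Ioo 0 1) := by
  have hmono := strictMonoOn_of_hasDerivAt_pos hU hu
  have key : ∀ p ∈ Ioo (0 : ℝ) 1, ∀ q ∈ Ioo (0 : ℝ) 1, ∀ p' ∈ Ioo (0 : ℝ) 1,
      ∀ q' ∈ Ioo (0 : ℝ) 1, p < q → q ≤ p' → p' < q' → U q - U p = U q' - U p' →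
      G q - G p < G q' - G p' := by
    intro p hp q hq p' hp' q' hq' hpq hqp hpq' hUU
    obtain ⟨z, hz, h1⟩ := exists_sub_eq_div_mul hU hu hG hp hq hpq
    obtain ⟨w, hw, h2⟩ := exists_sub_eq_div_mul hU hu hG hp' hq' hpq'
    rw [h1, h2, ← hUU]
    refine mul_lt_mul_of_pos_right (hh ⟨hp.1.trans hz.1, hz.2.trans hq.2⟩
      ⟨hp'.1.trans hw.1, hw.2.trans hq'.2⟩ (hz.2.trans_le (hqp.trans hw.1.le))) ?_
    exact sub_pos.2 (hmono hp hq hpq)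
  have hlt : ∀ x ∈ Ioo (0 : ℝ) 1, x < σ x := fun x hx =>
    (hmono.lt_iff_lt hx (hσ x hx).1).1 (by linarith [(hσ x hx).2])
  intro x hx y hy hxy
  have hx2 := hσ x hx
  have hy2 := hσ y hy
  have hU1 := hmono hx hy hxy
  rcases le_or_gt (σ x) y with h | h
  · exact key x hx _ hx2.1 y hy _ hy2.1 (hlt x hx) h (hlt y hy) (by linarith)
  -- When they overlap, drop the common part [y, σ x]: the remainders [x, y] and [σ x, σ y] again
  -- have equal U-length and do not overlap.
  · have hss : σ x < σ y := (hmono.lt_iff_lt hx2.1 hy2.1).1 (by linarith)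
    have := key x hx y hy _ hx2.1 _ hy2.1 hxy h.le hss (by linarith)
    dsimp only
    linarith

theorem strictAntiOn_sub_of_strictAntiOn_div
    (hU : ∀ x ∈ Ioo (0 : ℝ) 1, HasDerivAt U (u x) x)
    (hu : ∀ x ∈ Ioo (0 : ℝ) 1, 0 < u x) (hG : ∀ x ∈ Ioo (0 : ℝ) 1, HasDerivAt G (g x) x)
    (hh : StrictAntiOn (fun x => g x / u x) (Ioo 0 1))
    (hσ : ∀ x ∈ Ioo (0 : ℝ) 1, σ x ∈ Ioo (0 : ℝ) 1 ∧ U (σ x) = U x + k) (hk : 0 < k) :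
    StrictAntiOn (fun x => G (σ x) - G x) (Ioo 0 1) := by
  have h := strictMonoOn_sub_of_strictMonoOn_div (G := fun x => -G x) (g := fun x => -g x) hU hu
    (fun x hx => (hG x hx).fun_neg) (fun x hx y hy hxy => by
      simpa only [neg_div] using neg_lt_neg (hh hx hy hxy)) hσ hk
  intro x hx y hy hxy
  have := h hx hy hxy
  dsimp only at this ⊢
  linarith

theorem increasesOnto_of_shift (hU : StrictMonoOn U (Ioo 0 1)) {τ : ℝ → ℝ}
    (hσ : ∀ x ∈ Ioo (0 : ℝ) 1, σ x ∈ Ioo (0 : ℝ) 1 ∧ U (σ x) = U x + k)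
    (hστ : ∀ x ∈ Ioo (0 : ℝ) 1, τ x ∈ Ioo (0 : ℝ) 1 ∧ σ (τ x) = x) :
    IncreasesOnto σ (Ioo 0 1) := by
  refine ⟨fun x hx y hy hxy => ?_, Subset.antisymm ?_ fun y hy => ⟨τ y, hστ y hy⟩⟩
  · refine (hU.lt_iff_lt (hσ x hx).1 (hσ y hy).1).1 ?_
    linarith [(hσ x hx).2, (hσ y hy).2, hU hx hy hxy]
  · rintro _ ⟨x, hx, rfl⟩
    exact (hσ x hx).1

end Shift

/-! ### The complementary argument and the substitutions r² and 1-r -/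

theorem sq_mem_unitIoo {r : ℝ} (hr : r ∈ Ioo (0 : ℝ) 1) : r ^ 2 ∈ Ioo (0 : ℝ) 1 :=
  ⟨pow_pos hr.1 2, pow_lt_one₀ hr.1.le hr.2 two_ne_zero⟩

theorem one_sub_mem_unitIoo {x : ℝ} (hx : x ∈ Ioo (0 : ℝ) 1) : 1 - x ∈ Ioo (0 : ℝ) 1 :=
  ⟨by linarith [hx.2], by linarith [hx.1]⟩

theorem sq_lt_sq_of_mem {x y : ℝ} (hx : x ∈ Ioo (0 : ℝ) 1) (hxy : x < y) : x ^ 2 < y ^ 2 :=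
  pow_lt_pow_left₀ hxy hx.1.le two_ne_zero

theorem compl_sq {r : ℝ} (hr : r ∈ Ioo (0 : ℝ) 1) : compl r ^ 2 = 1 - r ^ 2 :=
  Real.sq_sqrt (one_sub_mem_unitIoo (sq_mem_unitIoo hr)).1.le

theorem compl_mem {r : ℝ} (hr : r ∈ Ioo (0 : ℝ) 1) : compl r ∈ Ioo (0 : ℝ) 1 := by
  have h := one_sub_mem_unitIoo (sq_mem_unitIoo hr)
  exact ⟨Real.sqrt_pos.2 h.1, (Real.sqrt_lt' one_pos).2 (by simpa using h.2)⟩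

theorem compl_compl {r : ℝ} (hr : r ∈ Ioo (0 : ℝ) 1) : compl (compl r) = r := by
  rw [compl, compl_sq hr, sub_sub_cancel, Real.sqrt_sq hr.1.le]

theorem compl_decreasesOnto : DecreasesOnto compl (Ioo 0 1) := by
  refine ⟨fun x hx y hy hxy => ?_, Subset.antisymm ?_ fun y hy =>
    ⟨compl y, compl_mem hy, compl_compl hy⟩⟩
  · exact Real.sqrt_lt_sqrt (one_sub_mem_unitIoo (sq_mem_unitIoo hy)).1.le
      (by linarith [sq_lt_sq_of_mem hx hxy])
  · rintro _ ⟨x, hx, rfl⟩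
    exact compl_mem hx

theorem tendsto_sq_zero : Tendsto (fun r : ℝ => r ^ 2) (𝓝[>] 0) (𝓝[>] 0) := by
  refine tendsto_nhdsWithin_iff.2 ⟨?_, ?_⟩
  · have : ContinuousAt (fun r : ℝ => r ^ 2) 0 := by fun_prop
    simpa using this.tendsto.mono_left nhdsWithin_le_nhds
  · filter_upwards [self_mem_nhdsWithin] with r hr using pow_pos (mem_Ioi.1 hr) 2

theorem tendsto_sq_one : Tendsto (fun r : ℝ => r ^ 2) (𝓝[<] 1) (𝓝[<] 1) := by
  refine tendsto_nhdsWithin_iff.2 ⟨?_, ?_⟩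
  · have : ContinuousAt (fun r : ℝ => r ^ 2) 1 := by fun_prop
    simpa using this.tendsto.mono_left nhdsWithin_le_nhds
  · filter_upwards [eventually_mem_unitIoo_one] with r hr using (sq_mem_unitIoo hr).2

theorem tendsto_one_sub_zero : Tendsto (fun r : ℝ => 1 - r) (𝓝[>] 0) (𝓝[<] 1) := by
  refine tendsto_nhdsWithin_iff.2 ⟨?_, ?_⟩
  · have : ContinuousAt (fun r : ℝ => 1 - r) 0 := by fun_prop
    simpa using this.tendsto.mono_left nhdsWithin_le_nhds
  · filter_upwards [self_mem_nhdsWithin] with r hr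
    simpa using hr

theorem tendsto_one_sub_one : Tendsto (fun r : ℝ => 1 - r) (𝓝[<] 1) (𝓝[>] 0) := by
  refine tendsto_nhdsWithin_iff.2 ⟨?_, ?_⟩
  · have : ContinuousAt (fun r : ℝ => 1 - r) 1 := by fun_prop
    simpa using this.tendsto.mono_left nhdsWithin_le_nhds
  · filter_upwards [self_mem_nhdsWithin] with r hr
    simpa using hr

/-! ### The logarithm of the modulus -/

/-- `log (F(r²) / F(1 - r²))`, which is `-log μ(r)` up to an additive constant. -/
noncomputable def logModulus (q c r : ℝ) : ℝ :=
  Real.log (zb q c (r ^ 2)) - Real.log (zb q c (1 - r ^ 2))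

section LogModulus

variable {q c : ℝ}

theorem hasDerivAt_log_zb_sq (hq : 0 < q) (hc : 0 < c) (hqc : q ≤ c) {r : ℝ}
    (hr : r ∈ Ioo (0 : ℝ) 1) :
    HasDerivAt (fun r => Real.log (zb q c (r ^ 2))) (2 * r * zbLogDeriv q c (r ^ 2)) r := by
  have h2 := sq_mem_unitIoo hr
  have hd := (hasDerivAt_zb hq hc hqc (abs_lt.2 ⟨by linarith [h2.1], h2.2⟩)).comp
    (h := fun r => r ^ 2) r (hasDerivAt_pow 2 r)
  convert! hd.log (zb_pos hq hc hqc h2.1.le h2.2).ne' using 1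
  simp only [zbLogDeriv, Function.comp]
  push_cast
  ring

theorem hasDerivAt_log_zb_one_sub_sq (hq : 0 < q) (hc : 0 < c) (hqc : q ≤ c) {r : ℝ}
    (hr : r ∈ Ioo (0 : ℝ) 1) :
    HasDerivAt (fun r => Real.log (zb q c (1 - r ^ 2)))
      (-(2 * r * zbLogDeriv q c (1 - r ^ 2))) r := by
  have h2 := one_sub_mem_unitIoo (sq_mem_unitIoo hr)
  have hd := (hasDerivAt_zb hq hc hqc (abs_lt.2 ⟨by linarith [h2.1], h2.2⟩)).comp r
    ((hasDerivAt_pow 2 r).const_sub 1)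
  convert! hd.log (zb_pos hq hc hqc h2.1.le h2.2).ne' using 1
  simp only [zbLogDeriv, Function.comp]
  push_cast
  ring

theorem hasDerivAt_logModulus (hq : 0 < q) (hc : 0 < c) (hqc : q ≤ c) {r : ℝ}
    (hr : r ∈ Ioo (0 : ℝ) 1) : HasDerivAt (logModulus q c)
      (2 * r * (zbLogDeriv q c (r ^ 2) + zbLogDeriv q c (1 - r ^ 2))) r := by
  convert! (hasDerivAt_log_zb_sq hq hc hqc hr).sub
    (hasDerivAt_log_zb_one_sub_sq hq hc hqc hr) using 1
  ring

theorem logModulus_deriv_pos (hq : 0 < q) (hc : 0 < c) (hqc : q ≤ c) {r : ℝ}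
    (hr : r ∈ Ioo (0 : ℝ) 1) :
    0 < 2 * r * (zbLogDeriv q c (r ^ 2) + zbLogDeriv q c (1 - r ^ 2)) := by
  have h2 := sq_mem_unitIoo hr
  have h3 := one_sub_mem_unitIoo h2
  have := zbLogDeriv_pos hq hc hqc h2.1.le h2.2
  have := zbLogDeriv_pos hq hc hqc h3.1.le h3.2
  have := hr.1
  positivity

theorem logModulus_strictMonoOn (hq : 0 < q) (hc : 0 < c) (hqc : q ≤ c) :
    StrictMonoOn (logModulus q c) (Ioo 0 1) :=
  strictMonoOn_of_hasDerivAt_pos (fun _ hx => hasDerivAt_logModulus hq hc hqc hx)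
    fun _ hx => logModulus_deriv_pos hq hc hqc hx

theorem tendsto_zb_zero (hq : 0 < q) (hc : 0 < c) (hqc : q ≤ c) :
    Tendsto (zb q c) (𝓝[>] 0) (𝓝 1) := by
  have := (hasDerivAt_zb hq hc hqc (x := 0) (by simp)).continuousAt.tendsto
  rw [zb_zero] at this
  exact this.mono_left nhdsWithin_le_nhds

/-- U → -∞ at 0 and U → ∞ at 1, since one of F(r²), F(1-r²) tends to 1 and the other to ∞. Every
translate of U is therefore attained, so that φ_L is a true inverse value. -/
theorem logModulus_surjOn (hq : 0 < q) (hc : 0 < c) (hqc : q ≤ c) :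
    SurjOn (logModulus q c) (Ioo 0 1) univ := by
  have hlog1 : Tendsto (fun x => Real.log (zb q c x)) (𝓝[<] 1) atTop :=
    Real.tendsto_log_atTop.comp (tendsto_zb_atTop hq hc hqc)
  have hlog0 : Tendsto (fun x => Real.log (zb q c x)) (𝓝[>] 0) (𝓝 0) := by
    simpa using (tendsto_zb_zero hq hc hqc).log one_ne_zero
  refine isPreconnected_unitIoo.intermediate_value_Iii
    (le_principal_iff.2 eventually_mem_unitIoo_zero)
    (le_principal_iff.2 eventually_mem_unitIoo_one)
    (fun x hx => (hasDerivAt_logModulus hq hc hqc hx).continuousAt.continuousWithinAt) ?_ ?_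
  · have := (hlog0.comp tendsto_sq_zero).add_atBot
      (tendsto_neg_atTop_atBot.comp (hlog1.comp (tendsto_one_sub_zero.comp tendsto_sq_zero)))
    exact this.congr fun r => by simp [logModulus, sub_eq_add_neg]
  · have := (hlog1.comp tendsto_sq_one).atTop_add
      (hlog0.comp (tendsto_one_sub_one.comp tendsto_sq_one)).neg
    exact this.congr fun r => by simp [logModulus, sub_eq_add_neg]

theorem logModulus_compl {r : ℝ} (hr : r ∈ Ioo (0 : ℝ) 1) :
    logModulus q c (compl r) = -logModulus q c r := by
  rw [logModulus, logModulus, compl_sq hr, sub_sub_cancel, neg_sub]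

/-! ### Monotonicity of the derivatives with respect to `logModulus` -/

theorem mul_zbLogDeriv_one_sub_strictMonoOn (hq : 0 < q) (hc : 0 < c) (hqc : q ≤ c) :
    StrictMonoOn (fun x => x * zbLogDeriv q c (1 - x)) (Ioo 0 1) := fun x hx y hy hxy => by
  simpa using one_sub_mul_zbLogDeriv_strictAntiOn hq hc hqc (one_sub_mem_unitIoo hy)
    (one_sub_mem_unitIoo hx) (sub_lt_sub_left hxy 1)

/-- Both xΛ(x) and xΛ(1-x) increase; the second is (1-y)Λ(y) at y = 1-x. -/
theorem mul_zbLogDeriv_add_strictMonoOn (hq : 0 < q) (hc : 0 < c) (hqc : q ≤ c)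
    (hqc' : q < c * (c + 1)) :
    StrictMonoOn (fun x => x * (zbLogDeriv q c x + zbLogDeriv q c (1 - x))) (Ioo 0 1) := by
  intro x hx y hy hxy
  have h1 := mul_zbLogDeriv_one_sub_strictMonoOn hq hc hqc hx hy hxy
  have h2 := mul_lt_mul'' hxy (zbLogDeriv_strictMonoOn hq hc hqc hqc' hx hy hxy) hx.1.le
    (zbLogDeriv_pos hq hc hqc hx.1.le hx.2).le
  dsimp only at h1 ⊢
  linarith

theorem mul_zbLogDeriv_add_pos (hq : 0 < q) (hc : 0 < c) (hqc : q ≤ c) {x : ℝ}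
    (hx : x ∈ Ioo (0 : ℝ) 1) : 0 < x * (zbLogDeriv q c x + zbLogDeriv q c (1 - x)) :=
  mul_pos hx.1 (add_pos (zbLogDeriv_pos hq hc hqc hx.1.le hx.2)
    (zbLogDeriv_pos hq hc hqc (sub_pos.2 hx.2).le (by linarith [hx.1])))

/-- The left side is d(log r)/dU; the right side is a function of r² alone. -/
theorem inv_div_logModulus_deriv {r : ℝ} :
    r⁻¹ / (2 * r * (zbLogDeriv q c (r ^ 2) + zbLogDeriv q c (1 - r ^ 2))) =
      (2 * (r ^ 2 * (zbLogDeriv q c (r ^ 2) + zbLogDeriv q c (1 - r ^ 2))))⁻¹ := by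
  rw [inv_eq_one_div r, div_div, inv_eq_one_div]
  congr 1
  ring

theorem inv_div_logModulus_deriv_strictAntiOn (hq : 0 < q) (hc : 0 < c) (hqc : q ≤ c)
    (hqc' : q < c * (c + 1)) :
    StrictAntiOn (fun r =>
      r⁻¹ / (2 * r * (zbLogDeriv q c (r ^ 2) + zbLogDeriv q c (1 - r ^ 2)))) (Ioo 0 1) := by
  intro x hx y hy hxy
  simp only [inv_div_logModulus_deriv]
  have h2 := mul_zbLogDeriv_add_strictMonoOn hq hc hqc hqc' (sq_mem_unitIoo hx)
    (sq_mem_unitIoo hy) (sq_lt_sq_of_mem hx hxy)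
  have h3 := mul_zbLogDeriv_add_pos hq hc hqc (sq_mem_unitIoo hx)
  dsimp only at h2
  exact inv_strictAnti₀ (by linarith) (by linarith)

theorem tendsto_inv_div_logModulus_deriv (hq : 0 < q) (hc : 0 < c) (hqc : q ≤ c) :
    Tendsto (fun r => r⁻¹ / (2 * r * (zbLogDeriv q c (r ^ 2) + zbLogDeriv q c (1 - r ^ 2))))
      (𝓝[>] 0) atTop := by
  simp only [inv_div_logModulus_deriv]
  refine tendsto_inv_nhdsGT_zero.comp (tendsto_nhdsWithin_iff.2 ⟨?_, ?_⟩)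
  · have h1 := (tendsto_mul_zbLogDeriv hq hc hqc).comp tendsto_sq_zero
    have h2 := (tendsto_one_sub_mul_zbLogDeriv hq hc hqc).comp
      (tendsto_one_sub_zero.comp tendsto_sq_zero)
    have h3 := (h1.add h2).const_mul 2
    simp only [add_zero, mul_zero] at h3
    refine h3.congr fun r => ?_
    simp only [Function.comp, sub_sub_cancel]
    ring
  · filter_upwards [eventually_mem_unitIoo_zero] with r hr
    exact mul_pos two_pos (mul_zbLogDeriv_add_pos hq hc hqc (sq_mem_unitIoo hr))

/-- After cancelling 2r this is Λ(x)/(Λ(x)+Λ(1-x)) at x = r², where Λ(x) increases and Λ(1-x)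
decreases. -/
theorem log_zb_div_logModulus_deriv_strictMonoOn (hq : 0 < q) (hc : 0 < c) (hqc : q ≤ c)
    (hqc' : q < c * (c + 1)) :
    StrictMonoOn (fun r => 2 * r * zbLogDeriv q c (r ^ 2) /
      (2 * r * (zbLogDeriv q c (r ^ 2) + zbLogDeriv q c (1 - r ^ 2)))) (Ioo 0 1) := by
  intro x hx y hy hxy
  have hx2 := sq_mem_unitIoo hx
  have hy2 := sq_mem_unitIoo hy
  have hx3 := one_sub_mem_unitIoo hx2
  have hy3 := one_sub_mem_unitIoo hy2
  have hxy2 := sq_lt_sq_of_mem hx hxy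
  have h1 := zbLogDeriv_strictMonoOn hq hc hqc hqc' hx2 hy2 hxy2
  have h2 := zbLogDeriv_strictMonoOn hq hc hqc hqc' hy3 hx3 (sub_lt_sub_left hxy2 1)
  have p1 := zbLogDeriv_pos hq hc hqc hx2.1.le hx2.2
  have p2 := zbLogDeriv_pos hq hc hqc hy2.1.le hy2.2
  have p3 := zbLogDeriv_pos hq hc hqc hx3.1.le hx3.2
  have p4 := zbLogDeriv_pos hq hc hqc hy3.1.le hy3.2
  dsimp only
  rw [mul_div_mul_left _ _ (mul_pos two_pos hx.1).ne',
    mul_div_mul_left _ _ (mul_pos two_pos hy.1).ne', div_lt_div_iff₀ (by positivity)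
    (by positivity)]
  have := mul_lt_mul'' h1 h2 p1.le p4.le
  linarith

/-- The quotient is (1-4xΛ(1-x))/(2x(Λ(x)+Λ(1-x))) at x = r²: a decreasing numerator over an
increasing positive denominator. The hypothesis 4q ≤ c keeps the numerator nonnegative. -/
theorem log_mul_zb_sq_div_logModulus_deriv_strictAntiOn (hq : 0 < q) (hc : 0 < c)
    (hqc : q ≤ c) (hqc' : q < c * (c + 1)) (h4 : 4 * q ≤ c) :
    StrictAntiOn (fun r => (r⁻¹ + 2 * -(2 * r * zbLogDeriv q c (1 - r ^ 2))) /
      (2 * r * (zbLogDeriv q c (r ^ 2) + zbLogDeriv q c (1 - r ^ 2)))) (Ioo 0 1) := by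
  have key : ∀ r ∈ Ioo (0 : ℝ) 1, (r⁻¹ + 2 * -(2 * r * zbLogDeriv q c (1 - r ^ 2))) /
      (2 * r * (zbLogDeriv q c (r ^ 2) + zbLogDeriv q c (1 - r ^ 2))) =
      (1 - 4 * (r ^ 2 * zbLogDeriv q c (1 - r ^ 2))) /
      (2 * (r ^ 2 * (zbLogDeriv q c (r ^ 2) + zbLogDeriv q c (1 - r ^ 2)))) := fun r hr => by
    have hr0 := hr.1.ne'
    rw [← mul_div_mul_left _ (2 * r * _) hr0]
    congr 1
    · field_simp
      ring
    · ring
  intro x hx y hy hxy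
  have hx2 := sq_mem_unitIoo hx
  have hy2 := sq_mem_unitIoo hy
  have hy3 := one_sub_mem_unitIoo hy2
  have hxy2 := sq_lt_sq_of_mem hx hxy
  have h1 := mul_zbLogDeriv_add_strictMonoOn hq hc hqc hqc' hx2 hy2 hxy2
  have h2 := mul_zbLogDeriv_one_sub_strictMonoOn hq hc hqc hx2 hy2 hxy2
  have h3 := mul_zbLogDeriv_add_pos hq hc hqc hx2
  have h5 := one_sub_mul_zbLogDeriv_le hq hc hqc hy3.1.le hy3.2
  have h6 : q / c ≤ 1 / 4 := by
    rw [div_le_iff₀ hc]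
    linarith
  rw [sub_sub_cancel] at h5
  dsimp only at h1 h2 ⊢
  rw [key x hx, key y hy]
  exact div_lt_div₀ (by linarith) (by linarith) (by linarith) (by linarith)

end LogModulus

/-! ### The modular function as a translation of `logModulus` -/

theorem ellipticK_eq {a c : ℝ} (hc : 0 < c) (r : ℝ) :
    ellipticK a c r = ProbabilityTheory.beta a (c - a) / 2 * zb (a * (c - a)) c (r ^ 2) := by
  rw [ellipticK, ellipticK₃, ordinaryHypergeometric_eq_zb hc]

theorem modulus₃_eq {a c r : ℝ} (hc : 0 < c) (hq : 0 < a * (c - a)) (hqc : a * (c - a) ≤ c)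
    (hr : r ∈ Ioo (0 : ℝ) 1) : modulus₃ a (c - a) c r =
      ProbabilityTheory.beta a (c - a) / 2 * Real.exp (-logModulus (a * (c - a)) c r) := by
  have h2 := sq_mem_unitIoo hr
  have h3 := one_sub_mem_unitIoo h2
  rw [modulus₃, ordinaryHypergeometric_eq_zb hc, ordinaryHypergeometric_eq_zb hc, compl_sq hr,
    logModulus, neg_sub, Real.exp_sub, Real.exp_log (zb_pos hq hc hqc h2.1.le h2.2),
    Real.exp_log (zb_pos hq hc hqc h3.1.le h3.2)]

/-- As μ = (B/2) e^{-U}, dividing μ by L adds log L to U. Surjectivity of U puts μ(r)/L in the range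
of μ, so `invFunOn` returns a genuine preimage and not a default value. -/
theorem modularPhi_spec {a c L r : ℝ} (ha : 0 < a) (hac : a < c) (hqc : a * (c - a) ≤ c)
    (hL : 0 < L) (hr : r ∈ Ioo (0 : ℝ) 1) : modularPhi L a c r ∈ Ioo (0 : ℝ) 1 ∧
      logModulus (a * (c - a)) c (modularPhi L a c r) =
        logModulus (a * (c - a)) c r + Real.log L := by
  have hc : 0 < c := ha.trans hac
  have hq : 0 < a * (c - a) := mul_pos ha (sub_pos.2 hac)
  have hB : 0 < ProbabilityTheory.beta a (c - a) / 2 :=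
    half_pos (ProbabilityTheory.beta_pos ha (sub_pos.2 hac))
  obtain ⟨y, hy, hyU⟩ := logModulus_surjOn hq hc hqc
    (mem_univ (logModulus (a * (c - a)) c r + Real.log L))
  have hex : ∃ y ∈ Ioo (0 : ℝ) 1, modulus₃ a (c - a) c y = modulus₃ a (c - a) c r / L := by
    refine ⟨y, hy, ?_⟩
    rw [modulus₃_eq hc hq hqc hy, modulus₃_eq hc hq hqc hr, hyU, neg_add, Real.exp_add,
      Real.exp_neg (Real.log L), Real.exp_log hL]
    ring
  have hmem : modularPhi L a c r ∈ Ioo (0 : ℝ) 1 := Function.invFunOn_mem hex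
  have heq : modulus₃ a (c - a) c (modularPhi L a c r) = modulus₃ a (c - a) c r / L :=
    Function.invFunOn_eq hex
  refine ⟨hmem, ?_⟩
  rw [modulus₃_eq hc hq hqc hmem, modulus₃_eq hc hq hqc hr, mul_div_assoc] at heq
  have := congrArg Real.log (mul_left_cancel₀ hB.ne' heq)
  rw [Real.log_exp, Real.log_div (Real.exp_pos _).ne' hL.ne', Real.log_exp] at this
  linarith

/-! ### Monotonicity and limits of the three basic ratios along the shift -/

section Shift

variable {q c k : ℝ} {σ τ : ℝ → ℝ}

theorem zb_sq_continuousOn (hq : 0 < q) (hc : 0 < c) (hqc : q ≤ c) :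
    ContinuousOn (fun r => zb q c (r ^ 2)) (Ioo 0 1) := fun r hr => by
  have h2 := sq_mem_unitIoo hr
  exact ((hasDerivAt_zb hq hc hqc (abs_lt.2 ⟨by linarith [h2.1], h2.2⟩)).continuousAt.comp
    (f := fun r => r ^ 2) (by fun_prop)).continuousWithinAt

theorem zb_one_sub_sq_continuousOn (hq : 0 < q) (hc : 0 < c) (hqc : q ≤ c) :
    ContinuousOn (fun r => zb q c (1 - r ^ 2)) (Ioo 0 1) := fun r hr => by
  have h2 := one_sub_mem_unitIoo (sq_mem_unitIoo hr)
  exact ((hasDerivAt_zb hq hc hqc (abs_lt.2 ⟨by linarith [h2.1], h2.2⟩)).continuousAt.comp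
    (f := fun r => 1 - r ^ 2) (by fun_prop)).continuousWithinAt

/-- The exponentiated shift relation. It exchanges an indeterminate ∞/∞ limit at one endpoint for a
ratio of quantities tending to 1. -/
theorem zb_one_sub_sq_div_eq (hq : 0 < q) (hc : 0 < c) (hqc : q ≤ c)
    (hσ : ∀ x ∈ Ioo (0 : ℝ) 1, σ x ∈ Ioo (0 : ℝ) 1 ∧
      logModulus q c (σ x) = logModulus q c x + k) {r : ℝ} (hr : r ∈ Ioo (0 : ℝ) 1) :
    zb q c (σ r ^ 2) / zb q c (r ^ 2) =
      Real.exp k * (zb q c (1 - σ r ^ 2) / zb q c (1 - r ^ 2)) := by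
  have h := (hσ r hr).2
  have hr2 := sq_mem_unitIoo hr
  have hs2 := sq_mem_unitIoo (hσ r hr).1
  have hr3 := one_sub_mem_unitIoo hr2
  have hs3 := one_sub_mem_unitIoo hs2
  have p1 := zb_pos hq hc hqc hr2.1.le hr2.2
  have p2 := zb_pos hq hc hqc hs2.1.le hs2.2
  have p3 := zb_pos hq hc hqc hr3.1.le hr3.2
  have p4 := zb_pos hq hc hqc hs3.1.le hs3.2
  rw [logModulus, logModulus, ← Real.log_div p2.ne' p4.ne', ← Real.log_div p1.ne' p3.ne'] at h
  have h' := congrArg Real.exp h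
  rw [Real.exp_log (by positivity), Real.exp_add, Real.exp_log (by positivity)] at h'
  field_simp at h' ⊢
  linarith

theorem tendsto_zb_sq_div (hq : 0 < q) (hc : 0 < c) (hqc : q ≤ c)
    (hσo : IncreasesOnto σ (Ioo 0 1)) :
    Tendsto (fun r => zb q c (σ r ^ 2) / zb q c (r ^ 2)) (𝓝[>] 0) (𝓝 1) := by
  have h := (tendsto_zb_zero hq hc hqc).comp tendsto_sq_zero
  have := (h.comp hσo.tendsto_zero).div h one_ne_zero
  rwa [div_one] at this

theorem tendsto_zb_one_sub_sq_div (hq : 0 < q) (hc : 0 < c) (hqc : q ≤ c)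
    (hσo : IncreasesOnto σ (Ioo 0 1)) :
    Tendsto (fun r => zb q c (1 - σ r ^ 2) / zb q c (1 - r ^ 2)) (𝓝[<] 1) (𝓝 1) := by
  have h := (tendsto_zb_zero hq hc hqc).comp (tendsto_one_sub_one.comp tendsto_sq_one)
  have := (h.comp hσo.tendsto_one).div h one_ne_zero
  rwa [div_one] at this

theorem strictAntiOn_div_of_log_sub {f : ℝ → ℝ} (hf : ∀ r ∈ Ioo (0 : ℝ) 1, 0 < f r)
    (hσ : ∀ r ∈ Ioo (0 : ℝ) 1, σ r ∈ Ioo (0 : ℝ) 1)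
    (h : StrictAntiOn (fun r => Real.log (f (σ r)) - Real.log (f r)) (Ioo 0 1)) :
    StrictAntiOn (fun r => f (σ r) / f r) (Ioo 0 1) := by
  intro x hx y hy hxy
  have := h hx hy hxy
  dsimp only at this ⊢
  rw [← Real.log_div (hf _ (hσ x hx)).ne' (hf x hx).ne',
    ← Real.log_div (hf _ (hσ y hy)).ne' (hf y hy).ne'] at this
  exact (Real.log_lt_log_iff (div_pos (hf _ (hσ y hy)) (hf y hy))
    (div_pos (hf _ (hσ x hx)) (hf x hx))).1 this

theorem strictMonoOn_div_of_log_sub {f : ℝ → ℝ} (hf : ∀ r ∈ Ioo (0 : ℝ) 1, 0 < f r)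
    (hσ : ∀ r ∈ Ioo (0 : ℝ) 1, σ r ∈ Ioo (0 : ℝ) 1)
    (h : StrictMonoOn (fun r => Real.log (f (σ r)) - Real.log (f r)) (Ioo 0 1)) :
    StrictMonoOn (fun r => f (σ r) / f r) (Ioo 0 1) := by
  intro x hx y hy hxy
  have := h hx hy hxy
  dsimp only at this ⊢
  rw [← Real.log_div (hf _ (hσ x hx)).ne' (hf x hx).ne',
    ← Real.log_div (hf _ (hσ y hy)).ne' (hf y hy).ne'] at this
  exact (Real.log_lt_log_iff (div_pos (hf _ (hσ x hx)) (hf x hx))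
    (div_pos (hf _ (hσ y hy)) (hf y hy))).1 this

/-- By the mean value theorem log(σ(r)/r) = k · d(log r)/dU at some z < σ(r). That derivative
decreases, so its value at σ(r) is a lower bound, and it blows up because σ(r) → 0. -/
theorem tendsto_shift_div_atTop (hq : 0 < q) (hc : 0 < c) (hqc : q ≤ c)
    (hqc' : q < c * (c + 1)) (hk : 0 < k)
    (hσ : ∀ x ∈ Ioo (0 : ℝ) 1, σ x ∈ Ioo (0 : ℝ) 1 ∧
      logModulus q c (σ x) = logModulus q c x + k)
    (hσo : IncreasesOnto σ (Ioo 0 1)) : Tendsto (fun r => σ r / r) (𝓝[>] 0) atTop := by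
  have h1 := ((tendsto_inv_div_logModulus_deriv hq hc hqc).comp hσo.tendsto_zero).atTop_mul_const hk
  refine tendsto_atTop_mono' _ ?_ (Real.tendsto_exp_atTop.comp h1)
  filter_upwards [eventually_mem_unitIoo_zero] with r hr
  have hs := (hσ r hr).1
  have hlt : r < σ r := ((logModulus_strictMonoOn hq hc hqc).lt_iff_lt hr hs).1
    (by linarith [(hσ r hr).2])
  obtain ⟨z, hz, h⟩ := exists_sub_eq_div_mul
    (fun x hx => hasDerivAt_logModulus hq hc hqc hx)
    (fun x hx => logModulus_deriv_pos hq hc hqc hx)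
    (fun x hx => Real.hasDerivAt_log hx.1.ne') hr hs hlt
  rw [(hσ r hr).2, add_sub_cancel_left, ← Real.log_div hs.1.ne' hr.1.ne'] at h
  have h3 := inv_div_logModulus_deriv_strictAntiOn hq hc hqc hqc'
    ⟨hr.1.trans hz.1, hz.2.trans hs.2⟩ hs hz.2
  rw [← Real.exp_log (div_pos hs.1 hr.1), h]
  exact Real.exp_le_exp.2 (mul_le_mul_of_nonneg_right h3.le hk.le)

theorem shift_div_decreasesOnto (hq : 0 < q) (hc : 0 < c) (hqc : q ≤ c)
    (hqc' : q < c * (c + 1)) (hk : 0 < k)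
    (hσ : ∀ x ∈ Ioo (0 : ℝ) 1, σ x ∈ Ioo (0 : ℝ) 1 ∧
      logModulus q c (σ x) = logModulus q c x + k)
    (hσo : IncreasesOnto σ (Ioo 0 1)) : DecreasesOnto (fun r => σ r / r) (Ioi 1) := by
  refine decreasesOnto_Ioi ?_ (hσo.continuousOn.div continuousOn_id fun r hr => hr.1.ne')
    (tendsto_shift_div_atTop hq hc hqc hqc' hk hσ hσo) ?_
  · exact strictAntiOn_div_of_log_sub (f := fun r => r) (fun r hr => hr.1)
      (fun r hr => (hσ r hr).1) (strictAntiOn_sub_of_strictAntiOn_div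
        (fun x hx => hasDerivAt_logModulus hq hc hqc hx)
        (fun x hx => logModulus_deriv_pos hq hc hqc hx)
        (fun x hx => Real.hasDerivAt_log hx.1.ne')
        (inv_div_logModulus_deriv_strictAntiOn hq hc hqc hqc') hσ hk)
  · have h1 : Tendsto σ (𝓝[<] 1) (𝓝 1) := hσo.tendsto_one.mono_right nhdsWithin_le_nhds
    have h2 : Tendsto (fun r : ℝ => r) (𝓝[<] 1) (𝓝 1) := tendsto_id.mono_left nhdsWithin_le_nhds
    have := h1.div h2 one_ne_zero
    rwa [div_one] at this

theorem zb_sq_div_increasesOnto (hq : 0 < q) (hc : 0 < c) (hqc : q ≤ c)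
    (hqc' : q < c * (c + 1)) (hk : 0 < k)
    (hσ : ∀ x ∈ Ioo (0 : ℝ) 1, σ x ∈ Ioo (0 : ℝ) 1 ∧
      logModulus q c (σ x) = logModulus q c x + k)
    (hσo : IncreasesOnto σ (Ioo 0 1)) :
    IncreasesOnto (fun r => zb q c (σ r ^ 2) / zb q c (r ^ 2)) (Ioo 1 (Real.exp k)) := by
  have hcont := zb_sq_continuousOn hq hc hqc
  have hpos : ∀ r ∈ Ioo (0 : ℝ) 1, 0 < zb q c (r ^ 2) := fun r hr =>
    zb_pos hq hc hqc (sq_mem_unitIoo hr).1.le (sq_mem_unitIoo hr).2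
  refine increasesOnto_Ioo ?_ ((hcont.comp hσo.continuousOn fun r hr => (hσ r hr).1).div hcont
    fun r hr => (hpos r hr).ne') (tendsto_zb_sq_div hq hc hqc hσo) ?_
  · exact strictMonoOn_div_of_log_sub (f := fun r => zb q c (r ^ 2)) hpos
      (fun r hr => (hσ r hr).1) (strictMonoOn_sub_of_strictMonoOn_div
        (fun x hx => hasDerivAt_logModulus hq hc hqc hx)
        (fun x hx => logModulus_deriv_pos hq hc hqc hx)
        (fun x hx => hasDerivAt_log_zb_sq hq hc hqc hx)
        (log_zb_div_logModulus_deriv_strictMonoOn hq hc hqc hqc') hσ hk)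
  · have h := (tendsto_zb_one_sub_sq_div hq hc hqc hσo).const_mul (Real.exp k)
    rw [mul_one] at h
    refine h.congr' ?_
    filter_upwards [eventually_mem_unitIoo_one] with r hr
    exact (zb_one_sub_sq_div_eq hq hc hqc hσ hr).symm

theorem mul_zb_one_sub_sq_div_decreasesOnto (hq : 0 < q) (hc : 0 < c) (hqc : q ≤ c)
    (hqc' : q < c * (c + 1)) (h4 : 4 * q ≤ c) (hk : 0 < k)
    (hσ : ∀ x ∈ Ioo (0 : ℝ) 1, σ x ∈ Ioo (0 : ℝ) 1 ∧
      logModulus q c (σ x) = logModulus q c x + k)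
    (hσo : IncreasesOnto σ (Ioo 0 1)) :
    DecreasesOnto (fun r => σ r * zb q c (1 - σ r ^ 2) ^ 2 / (r * zb q c (1 - r ^ 2) ^ 2))
      (Ioi 1) := by
  have hz : ∀ r ∈ Ioo (0 : ℝ) 1, 0 < zb q c (1 - r ^ 2) := fun r hr =>
    have h := one_sub_mem_unitIoo (sq_mem_unitIoo hr)
    zb_pos hq hc hqc h.1.le h.2
  have hpos : ∀ r ∈ Ioo (0 : ℝ) 1, 0 < r * zb q c (1 - r ^ 2) ^ 2 := fun r hr =>
    mul_pos hr.1 (pow_pos (hz r hr) 2)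
  have hcont : ContinuousOn (fun r => r * zb q c (1 - r ^ 2) ^ 2) (Ioo 0 1) :=
    continuousOn_id.mul ((zb_one_sub_sq_continuousOn hq hc hqc).pow 2)
  have hlog : ∀ r ∈ Ioo (0 : ℝ) 1, Real.log (r * zb q c (1 - r ^ 2) ^ 2) =
      Real.log r + 2 * Real.log (zb q c (1 - r ^ 2)) := fun r hr => by
    rw [Real.log_mul hr.1.ne' (pow_pos (hz r hr) 2).ne', Real.log_pow]
    push_cast
    rfl
  have hsplit : ∀ r, σ r * zb q c (1 - σ r ^ 2) ^ 2 / (r * zb q c (1 - r ^ 2) ^ 2) =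
      σ r / r * (zb q c (1 - σ r ^ 2) / zb q c (1 - r ^ 2)) ^ 2 := fun r => by
    rw [mul_div_mul_comm, div_pow]
  refine decreasesOnto_Ioi ?_ ((hcont.comp hσo.continuousOn fun r hr => (hσ r hr).1).div hcont
    fun r hr => (hpos r hr).ne') ?_ ?_
  · refine strictAntiOn_div_of_log_sub (f := fun r => r * zb q c (1 - r ^ 2) ^ 2) hpos
      (fun r hr => (hσ r hr).1) ?_
    refine (strictAntiOn_sub_of_strictAntiOn_div
      (G := fun r => Real.log r + 2 * Real.log (zb q c (1 - r ^ 2)))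
      (fun x hx => hasDerivAt_logModulus hq hc hqc hx)
      (fun x hx => logModulus_deriv_pos hq hc hqc hx)
      (fun x hx => (Real.hasDerivAt_log hx.1.ne').add
        ((hasDerivAt_log_zb_one_sub_sq hq hc hqc hx).const_mul 2))
      (log_mul_zb_sq_div_logModulus_deriv_strictAntiOn hq hc hqc hqc' h4) hσ hk).congr
      fun r hr => ?_
    simp only [hlog r hr, hlog _ (hσ r hr).1]
  · simp only [hsplit]
    -- At 0 the F(1-r²) ratio is e^{-k} times the F(r²) ratio, hence tends to e^{-k} > 0 and cannot
    -- offset σ(r)/r → ∞.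
    refine (tendsto_shift_div_atTop hq hc hqc hqc' hk hσ hσo).atTop_mul_pos
      (C := (1 / Real.exp k) ^ 2) (by positivity) (Tendsto.pow ?_ 2)
    refine ((tendsto_zb_sq_div hq hc hqc hσo).div_const (Real.exp k)).congr' ?_
    filter_upwards [eventually_mem_unitIoo_zero] with r hr
    rw [zb_one_sub_sq_div_eq hq hc hqc hσ hr, mul_div_cancel_left₀ _ (Real.exp_pos k).ne']
  · simp only [hsplit]
    have h1 : Tendsto σ (𝓝[<] 1) (𝓝 1) := hσo.tendsto_one.mono_right nhdsWithin_le_nhds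
    have h2 : Tendsto (fun r : ℝ => r) (𝓝[<] 1) (𝓝 1) := tendsto_id.mono_left nhdsWithin_le_nhds
    simpa using (h1.div h2 one_ne_zero).mul ((tendsto_zb_one_sub_sq_div hq hc hqc hσo).pow 2)

end Shift

/-! ### Reciprocals of intervals and the twelve statements -/

theorem inv_Ioi_one : (Ioi (1 : ℝ))⁻¹ = Ioo 0 1 := by
  ext x
  simp only [Set.mem_inv, mem_Ioi, mem_Ioo, one_lt_inv_iff₀]

theorem inv_Ioo_zero_one : (Ioo (0 : ℝ) 1)⁻¹ = Ioi 1 := by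
  rw [← inv_Ioi_one, inv_inv]

theorem inv_Ioo_one {K : ℝ} (hK : 0 < K) : (Ioo (1 : ℝ) K)⁻¹ = Ioo (1 / K) 1 := by
  ext x
  simp only [Set.mem_inv, mem_Ioo, one_lt_inv_iff₀, one_div]
  constructor
  · rintro ⟨⟨h0, h1⟩, h2⟩
    exact ⟨(inv_lt_comm₀ h0 hK).1 h2, h1⟩
  · rintro ⟨h1, h2⟩
    have h0 : 0 < x := (inv_pos.2 hK).trans h1
    exact ⟨⟨h0, h2⟩, (inv_lt_comm₀ h0 hK).2 h1⟩

theorem inv_Ioo_one_div {K : ℝ} (hK : 0 < K) : (Ioo (1 / K) 1)⁻¹ = Ioo (1 : ℝ) K := by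
  rw [← inv_Ioo_one hK, inv_inv]

end GenElliptic

open GenElliptic

theorem mainTheorem5 (a c K : ℝ) (ha : 0 < a) (hac : a < c) (hc : c ≤ 1) (hK : 1 < K)
    (s t : ℝ → ℝ) (hs : s = GenElliptic.modularPhi K a c)
    (ht : t = GenElliptic.modularPhi (1 / K) a c) :
    GenElliptic.DecreasesOnto (fun r => s r / r) (Set.Ioi 1) ∧
    GenElliptic.DecreasesOnto (fun r => GenElliptic.compl (s r) / GenElliptic.compl r)
      (Set.Ioo 0 1) ∧
    GenElliptic.IncreasesOnto
      (fun r => GenElliptic.ellipticK a c (s r) / GenElliptic.ellipticK a c r)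
      (Set.Ioo 1 K) ∧
    GenElliptic.IncreasesOnto
      (fun r => GenElliptic.ellipticK' a c (s r) / GenElliptic.ellipticK' a c r)
      (Set.Ioo (1 / K) 1) ∧
    GenElliptic.DecreasesOnto
      (fun r => GenElliptic.compl (s r) * GenElliptic.ellipticK a c (s r) ^ 2 /
        (GenElliptic.compl r * GenElliptic.ellipticK a c r ^ 2))
      (Set.Ioo 0 1) ∧
    GenElliptic.DecreasesOnto
      (fun r => s r * GenElliptic.ellipticK' a c (s r) ^ 2 /
        (r * GenElliptic.ellipticK' a c r ^ 2))
      (Set.Ioi 1) ∧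
    GenElliptic.IncreasesOnto (fun r => t r / r) (Set.Ioo 0 1) ∧
    GenElliptic.IncreasesOnto (fun r => GenElliptic.compl (t r) / GenElliptic.compl r)
      (Set.Ioi 1) ∧
    GenElliptic.DecreasesOnto
      (fun r => GenElliptic.ellipticK a c (t r) / GenElliptic.ellipticK a c r)
      (Set.Ioo (1 / K) 1) ∧
    GenElliptic.DecreasesOnto
      (fun r => GenElliptic.ellipticK' a c (t r) / GenElliptic.ellipticK' a c r)
      (Set.Ioo 1 K) ∧
    GenElliptic.IncreasesOnto
      (fun r => GenElliptic.compl (t r) * GenElliptic.ellipticK a c (t r) ^ 2 /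
        (GenElliptic.compl r * GenElliptic.ellipticK a c r ^ 2))
      (Set.Ioi 1) ∧
    GenElliptic.IncreasesOnto
      (fun r => t r * GenElliptic.ellipticK' a c (t r) ^ 2 /
        (r * GenElliptic.ellipticK' a c r ^ 2))
      (Set.Ioo 0 1) := by
  have hc0 : 0 < c := ha.trans hac
  have hK0 : 0 < K := one_pos.trans hK
  have hq : 0 < a * (c - a) := mul_pos ha (sub_pos.2 hac)
  -- 4a(c-a) = c² - (c-2a)² ≤ c² ≤ c, the last step because c ≤ 1.
  have h4 : 4 * (a * (c - a)) ≤ c := by nlinarith [sq_nonneg (c - 2 * a)]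
  have hqc : a * (c - a) ≤ c := by linarith
  have hqc' : a * (c - a) < c * (c + 1) := by nlinarith
  have hk : 0 < Real.log K := Real.log_pos hK
  have hB : ProbabilityTheory.beta a (c - a) / 2 ≠ 0 :=
    (half_pos (ProbabilityTheory.beta_pos ha (sub_pos.2 hac))).ne'
  have hσ : ∀ x ∈ Ioo (0 : ℝ) 1, s x ∈ Ioo (0 : ℝ) 1 ∧ logModulus (a * (c - a)) c (s x) =
      logModulus (a * (c - a)) c x + Real.log K := fun x hx =>
    hs ▸ modularPhi_spec ha hac hqc hK0 hx
  have hτ : ∀ x ∈ Ioo (0 : ℝ) 1, t x ∈ Ioo (0 : ℝ) 1 ∧ logModulus (a * (c - a)) c (t x) =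
      logModulus (a * (c - a)) c x + -Real.log K := fun x hx => by
    have := modularPhi_spec (L := 1 / K) ha hac hqc (by positivity) hx
    rw [one_div, Real.log_inv, ← one_div] at this
    exact ht ▸ this
  have hmono := logModulus_strictMonoOn hq hc0 hqc
  have hστ : ∀ x ∈ Ioo (0 : ℝ) 1, s (t x) = x := fun x hx =>
    hmono.injOn (hσ _ (hτ x hx).1).1 hx (by rw [(hσ _ (hτ x hx).1).2, (hτ x hx).2]; ring)
  have hτσ : ∀ x ∈ Ioo (0 : ℝ) 1, t (s x) = x := fun x hx =>
    hmono.injOn (hτ _ (hσ x hx).1).1 hx (by rw [(hτ _ (hσ x hx).1).2, (hσ x hx).2]; ring)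
  have hso : IncreasesOnto s (Ioo 0 1) :=
    increasesOnto_of_shift hmono hσ fun x hx => ⟨(hτ x hx).1, hστ x hx⟩
  have hto : IncreasesOnto t (Ioo 0 1) :=
    increasesOnto_of_shift hmono hτ fun x hx => ⟨(hσ x hx).1, hτσ x hx⟩
  -- Conjugation by `compl` reverses the shift: U takes the value -U(x) - log K at compl (s x), and
  -- s adds log K back.
  have hcs : ∀ x ∈ Ioo (0 : ℝ) 1, s (compl (s x)) = compl x := fun x hx => by
    have h1 := compl_mem (hσ x hx).1
    refine hmono.injOn (hσ _ h1).1 (compl_mem hx) ?_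
    rw [(hσ _ h1).2, logModulus_compl (hσ x hx).1, logModulus_compl hx, (hσ x hx).2]
    ring
  have hcso : DecreasesOnto (fun r => compl (s r)) (Ioo 0 1) := by
    refine ⟨fun x hx y hy hxy => compl_decreasesOnto.1 (hσ x hx).1 (hσ y hy).1
      (hso.1 hx hy hxy), ?_⟩
    rw [← image_image compl s, hso.2, compl_decreasesOnto.2]
  have hcc : ∀ x ∈ Ioo (0 : ℝ) 1, compl (compl (s x)) = s x := fun x hx => compl_compl (hσ x hx).1
  -- Since s(t r) = r, every ratio for t at r is the reciprocal of the same ratio for s at t r.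
  have hinvτ : ∀ g : ℝ → ℝ, ∀ r ∈ Ioo (0 : ℝ) 1, g (t r) / g r = (g (s (t r)) / g (t r))⁻¹ :=
    fun g r hr => by rw [hστ r hr, inv_div]
  have hsub1 : Ioi (1 : ℝ) ⊆ Ioi 0 := Ioi_subset_Ioi zero_le_one
  have hsub2 : Ioo (0 : ℝ) 1 ⊆ Ioi 0 := fun x hx => hx.1
  have hsub3 : Ioo 1 K ⊆ Ioi 0 := fun x hx => one_pos.trans hx.1
  have hsub4 : Ioo (1 / K) 1 ⊆ Ioi 0 := fun x hx => (one_div_pos.2 hK0).trans hx.1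
  have H1 : DecreasesOnto (fun r => s r / r) (Ioi 1) :=
    shift_div_decreasesOnto hq hc0 hqc hqc' hk hσ hso
  have H3 : IncreasesOnto (fun r => ellipticK a c (s r) / ellipticK a c r) (Ioo 1 K) := by
    have h := zb_sq_div_increasesOnto hq hc0 hqc hqc' hk hσ hso
    rw [Real.exp_log hK0] at h
    simpa only [ellipticK_eq hc0, mul_div_mul_left _ _ hB] using h
  have H6 : DecreasesOnto (fun r => s r * ellipticK' a c (s r) ^ 2 /
      (r * ellipticK' a c r ^ 2)) (Ioi 1) := by
    have h := mul_zb_one_sub_sq_div_decreasesOnto hq hc0 hqc hqc' h4 hk hσ hso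
    have e : ∀ r ∈ Ioo (0 : ℝ) 1, s r * ellipticK' a c (s r) ^ 2 / (r * ellipticK' a c r ^ 2) =
        s r * zb (a * (c - a)) c (1 - s r ^ 2) ^ 2 /
          (r * zb (a * (c - a)) c (1 - r ^ 2) ^ 2) := fun r hr => by
      rw [ellipticK', ellipticK', ellipticK_eq hc0, ellipticK_eq hc0, compl_sq hr,
        compl_sq (hσ r hr).1, mul_pow, mul_pow, mul_left_comm, mul_left_comm r,
        mul_div_mul_left _ _ (pow_ne_zero 2 hB)]
    exact ⟨h.1.congr fun r hr => (e r hr).symm, (image_congr e).trans h.2⟩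
  -- At e = compl (s r) the ratio s(e)/e of (1) equals compl r / compl (s r). The same substitution
  -- takes (3) to (4) and (6) to (5).
  have H2 : DecreasesOnto (fun r => compl (s r) / compl r) (Ioo 0 1) :=
    inv_Ioi_one ▸ H1.inv_comp_decreasing hsub1 hcso fun r hr => by
      simp only [hcs r hr, inv_div]
  have H4 : IncreasesOnto (fun r => ellipticK' a c (s r) / ellipticK' a c r) (Ioo (1 / K) 1) :=
    inv_Ioo_one hK0 ▸ H3.inv_comp_decreasing hsub3 hcso fun r hr => by
      simp only [hcs r hr, inv_div, ellipticK']
  have H5 : DecreasesOnto (fun r => compl (s r) * ellipticK a c (s r) ^ 2 /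
      (compl r * ellipticK a c r ^ 2)) (Ioo 0 1) :=
    inv_Ioi_one ▸ H6.inv_comp_decreasing hsub1 hcso fun r hr => by
      simp only [hcs r hr, inv_div, ellipticK', hcc r hr, compl_compl hr]
  refine ⟨H1, H2, H3, H4, H5, H6, ?_, ?_, ?_, ?_, ?_, ?_⟩
  · exact inv_Ioi_one ▸ H1.inv_comp_increasing hsub1 hto (hinvτ fun r => r)
  · exact inv_Ioo_zero_one ▸ H2.inv_comp_increasing hsub2 hto (hinvτ compl)
  · exact inv_Ioo_one hK0 ▸ H3.inv_comp_increasing hsub3 hto (hinvτ (ellipticK a c))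
  · exact inv_Ioo_one_div hK0 ▸ H4.inv_comp_increasing hsub4 hto (hinvτ (ellipticK' a c))
  · exact inv_Ioo_zero_one ▸ H5.inv_comp_increasing hsub2 hto
      (hinvτ fun r => compl r * ellipticK a c r ^ 2)
  · exact inv_Ioi_one ▸ H6.inv_comp_increasing hsub1 hto
      (hinvτ fun r => r * ellipticK' a c r ^ 2)
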